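/- **Setting.** Let $N=N_TQ$ with integers $N_T,Q\ge 1$. Let $\mathbf x=(x_1,\dots,x_N)$ be a proper (circularly symmetric) zero-mean complex Gaussian vector with covariance $K_{\mathbf x}=\mathbb E[\mathbf x\mathbf x^\dagger]$ of rank $s\ge 1$ and trace $P_x>0$, all of whose non-zero eigenvalues are equal: $K_{\mathbf x}=U_s\,(\tfrac{P_x}{s}I_s)\,U_s^\dagger$ with $U_s\in\mathbb C^{N\times s}$, $U_s^\dagger U_s=I_s$. Let $\mathbf w$ be a proper zero-mean complex Gaussian vector with covariance $\sigma_w^2I_N$, $\sigma_w^2>0$, independent of $\mathbf x$. Let $u_i\in\mathbb C^s$ be the $i$-th column of $U_s^\dagger$, $\eta_L=\min_i\|u_i\|^2$, $\eta_U=\max_i\|u_i\|^2$, and suppose $\eta_L>0$. The energy arrivals $E_1,\dots,E_N$ are i.i.d. real random variables, independent of $(\mathbf x,\mathbf w)$, with mean $\mu_E>0$ and variance $\varrho_E$, and $0\le E_t\le r_E\mu_E$ almost surely for a constant $r_E\ge1$. Time is divided into $N_T$ slots of $Q$ epochs. For $k=1,\dots,N_T$ put $\bar{\mathbf x}_k=(x_{(k-1)Q+1},\dots,x_{kQ})$,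 similarly $\bar{\mathbf w}_k$, and $\bar E_k=\sum_{t=1}^QE_{(k-1)Q+t}$. At the end of slot $k$ the buffer and the battery are emptied: the receiver obtains $\bar{\mathbf y}_k=\sqrt{p_k}\,\bar{\mathbf x}_k+\bar{\mathbf w}_k$, where $p_k\ge0$ is determined by $\mathbb E_S[\|\sqrt{p_k}\,\bar{\mathbf x}_k\|^2]=\bar E_k$. Here $\mathbb E_S$ is the expectation over $(\mathbf x,\mathbf w)$ for fixed energy arrivals. With $\mathbf y=(\bar{\mathbf y}_1,\dots,\bar{\mathbf y}_{N_T})$, let $$\varepsilon=\mathbb E_S\big[\|\mathbf x-\mathbb E_S[\mathbf x\mid\mathbf y]\|^2\big]$$ be the MMSE, a function of the energy arrivals; $\mathbb P$ denotes probability over the energy arrivals. Put $h(a)=(1+a)\log(1+a)-a$ for $a\ge 0$, and, for $\mu,r>0$, $$f_{bt}(\mu,\varrho,r)=2s\exp\Big(-\frac{\varrho}{\mu^2}h\Big(\frac{\mu r}{\varrho}\Big)\Big)\ (\varrho>0),\qquad f_{bt}(\mu,0,r)=\lim_{\varrho\downarrow0}f_{bt}(\mu,\varrho,r)=0,$$ $$f_{bn}(\mu,\varrho,r)=2s\exp\Big(-\frac{r^2/2}{\mu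 r/3+\varrho}\Big)\ (\varrho\ge0).$$ **Theorem.** *Bound I.* For every $r\in(0,1/\eta_U]$, $$\mathbb P(\varepsilon<\varepsilon_I)\ \ge\ 1-f_{bt}(\mu_I,\varrho_I,r)\ \ge\ 1-f_{bn}(\mu_I,\varrho_I,r),$$ where $$\varepsilon_I=\frac{P_x}{1+\frac{1}{\sigma_w^2}\mu_E\big(\frac1{\eta_U}-r\big)},\quad \mu_I=\frac1{\eta_L}\max\{r_E-1,1\}\min\{Q\eta_U,1\},\quad \varrho_I=\frac{\varrho_E}{\mu_E^2}\,\frac1{\eta_L^2}\,\frac1Q\min\{Q\eta_U,1\}.$$ *Bound II.* Let $\gamma\in(0,Qr_E]$ be such that $\bar p=\mathbb P(\bar E_k\ge\gamma\mu_E)$ (which does not depend on $k$) is positive. For every $r\in(0,1/\eta_U]$, $$\mathbb P(\varepsilon<\varepsilon_{II})\ \ge\ 1-f_{bt}(\mu_{II},\varrho_{II},r)\ \ge\ 1-f_{bn}(\mu_{II},\varrho_{II},r),$$ where $$\varepsilon_{II}=\frac{P_x}{1+\frac{1}{\sigma_w^2}\frac1Q\,\bar p\,\gamma\,\mu_E\big(\frac1{\eta_U}-r\big)},\quad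 \mu_{II}=\frac1{\eta_L}\max\Big\{\frac1{\bar p}-1,1\Big\}\min\{Q\eta_U,1\},\quad \varrho_{II}=\frac1{\eta_L^2}\Big(\frac1{\bar p}-1\Big)\min\{Q\eta_U,1\}.$$ -/

import Mathlib

open MeasureTheory ProbabilityTheory Matrix

namespace EnergyHarvesting

noncomputable section

/-! ### Signal model -/

/-- `z` is a proper (circularly symmetric) zero-mean complex Gaussian vector with covariance
`K = E[z zᴴ]`: it is jointly Gaussian (as a real vector), it has mean zero, covariance `K`, and
vanishing pseudo-covariance `E[z zᵀ] = 0`. -/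
structure IsProperComplexGaussian {Ω ι : Type*} [MeasurableSpace Ω] [Fintype ι]
    (P : Measure Ω) (z : Ω → EuclideanSpace ℂ ι) (K : Matrix ι ι ℂ) : Prop where
  measurable : Measurable z
  gaussian : HasGaussianLaw z P
  mean_eq_zero : ∀ i, ∫ ω, z ω i ∂P = 0
  covariance_eq : ∀ i j, ∫ ω, z ω i * star (z ω j) ∂P = K i j
  pseudoCovariance_eq : ∀ i j, ∫ ω, z ω i * z ω j ∂P = 0

/-- `K` has rank `s` and trace `Px`, and `K = U Λ Uᴴ` is a reduced eigenvalue decomposition in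
which all `s` non-zero eigenvalues are equal: `Uᴴ U = 1` and `Λ = (Px / s) • 1`. -/
structure IsFlatReducedEVD {ι : Type*} [Fintype ι] {s : ℕ}
    (K : Matrix ι ι ℂ) (U : Matrix ι (Fin s) ℂ) (Px : ℝ) : Prop where
  rank_eq : K.rank = s
  trace_eq : K.trace = (Px : ℂ)
  orthonormal : Uᴴ * U = 1
  decomposition : K = U * Matrix.diagonal (fun _ : Fin s => ((Px / s : ℝ) : ℂ)) * Uᴴ

/-- `u_i`, the `i`-th column of `Uᴴ`, as a Euclidean vector. -/
def uCol {ι : Type*} {s : ℕ} (U : Matrix ι (Fin s) ℂ) (i : ι) : EuclideanSpace ℂ (Fin s) :=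
  WithLp.toLp 2 (fun j => Uᴴ j i)

/-- `η_L = min_i ‖u_i‖²`. -/
def etaL {ι : Type*} {s : ℕ} (U : Matrix ι (Fin s) ℂ) : ℝ := ⨅ i, ‖uCol U i‖ ^ 2

/-- `η_U = max_i ‖u_i‖²`. -/
def etaU {ι : Type*} {s : ℕ} (U : Matrix ι (Fin s) ℂ) : ℝ := ⨆ i, ‖uCol U i‖ ^ 2

/-! ### The slotted block amplify-and-forward scheme

There are `NT` slots of `Q` epochs each. Epochs are indexed by `Fin (NT * Q)`; the `t`-th epoch of
slot `k` is `finProdFinEquiv (k, t) = t + Q * k`, and epoch `i` lies in slot `i.divNat = i / Q`. -/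

/-- Contents of the data buffer at the end of slot `k`. -/
def buffer {NT Q : ℕ} (x : EuclideanSpace ℂ (Fin (NT * Q))) (k : Fin NT) :
    EuclideanSpace ℂ (Fin Q) :=
  WithLp.toLp 2 (fun t => x (finProdFinEquiv (k, t)))

/-- Energy collected by the battery during slot `k`. -/
def slotEnergy {NT Q : ℕ} {Ω : Type*} (E : Fin (NT * Q) → Ω → ℝ) (k : Fin NT) (ω : Ω) : ℝ :=
  ∑ t : Fin Q, E (finProdFinEquiv (k, t)) ω

/-- Energy `J_k = E_S[‖√p x̄_k‖²]` spent in slot `k` with amplification factor `p` (slots have unit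
duration). -/
def txEnergy {NT Q : ℕ} {Ω : Type*} [MeasurableSpace Ω] (P : Measure Ω)
    (x : Ω → EuclideanSpace ℂ (Fin (NT * Q))) (p : ℝ) (k : Fin NT) : ℝ :=
  ∫ ω, ‖(Real.sqrt p : ℂ) • buffer (x ω) k‖ ^ 2 ∂P

/-- The received vector: `ȳ_k = √p_k x̄_k + w̄_k` in every slot `k`. -/
def received {NT Q : ℕ} {Ω : Type*} (p : Fin NT → ℝ)
    (x w : Ω → EuclideanSpace ℂ (Fin (NT * Q))) (ω : Ω) : EuclideanSpace ℂ (Fin (NT * Q)) :=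
  WithLp.toLp 2 (fun i => (Real.sqrt (p i.divNat) : ℂ) * x ω i + w ω i)

/-- The minimum mean-square error `E[‖x - E[x | y]‖²]`. -/
def mmse {Ω ι : Type*} [MeasurableSpace Ω] [Fintype ι] (P : Measure Ω)
    (x y : Ω → EuclideanSpace ℂ ι) : ℝ :=
  ∫ ω, ‖x ω - (P[x | MeasurableSpace.comap y inferInstance]) ω‖ ^ 2 ∂P

/-! ### The functions in the bounds -/

/-- `h(a) = (1 + a) log (1 + a) - a`. -/
def hfun (a : ℝ) : ℝ := (1 + a) * Real.log (1 + a) - a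

/-- `f_bt(μ, ϱ, r) = 2 s exp(-(ϱ / μ²) h(μ r / ϱ))`; at `ϱ = 0`, where this expression is
undefined, the value is its limit `0` as `ϱ` decreases to `0` (for `μ, r > 0`). -/
def fbt (s : ℕ) (μ ϱ r : ℝ) : ℝ :=
  if ϱ = 0 then 0 else 2 * s * Real.exp (-(ϱ / μ ^ 2) * hfun (μ * r / ϱ))

/-- `f_bn(μ, ϱ, r) = 2 s exp(-(r² / 2) / (μ r / 3 + ϱ))`. -/
def fbn (s : ℕ) (μ ϱ r : ℝ) : ℝ :=
  2 * s * Real.exp (-(r ^ 2 / 2) / (μ * r / 3 + ϱ))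

def errI (Px σw2 μE ηU r : ℝ) : ℝ := 1 / (1 + 1 / σw2 * μE * (1 / ηU - r)) * Px

def muI (Q : ℕ) (ηL ηU rE : ℝ) : ℝ := 1 / ηL * max (rE - 1) 1 * min (Q * ηU) 1

def rhoI (Q : ℕ) (ηL ηU μE ϱE : ℝ) : ℝ :=
  ϱE / μE ^ 2 * (1 / ηL ^ 2) * (1 / Q) * min (Q * ηU) 1

def errII (Q : ℕ) (Px σw2 μE ηU γ pbar r : ℝ) : ℝ :=
  1 / (1 + 1 / σw2 * (1 / Q) * pbar * γ * μE * (1 / ηU - r)) * Px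

def muII (Q : ℕ) (ηL ηU pbar : ℝ) : ℝ := 1 / ηL * max (1 / pbar - 1) 1 * min (Q * ηU) 1

def rhoII (Q : ℕ) (ηL ηU pbar : ℝ) : ℝ := 1 / ηL ^ 2 * (1 / pbar - 1) * min (Q * ηU) 1

end

end EnergyHarvesting

open EnergyHarvesting

/-! Let `G_k` be the Gram matrix of the vectors `u_i` over slot `k`, `w_k` its trace and `B_k = (Q /
w_k) G_k`; the `G_k` add up to the identity. A Wiener filter bounds the MMSE by `(Px / s) tr T⁻¹`
with `T = 1 + σ_w⁻² ∑ (Ē_k / w_k) G_k`, the factors `p_k` having been eliminated through the energy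
constraint (`mmse_received_le`, `txEnergy_eq`). Suppose `Ē_k ≥ a Q b_k` with independent `b_k` of
mean one. Then `T ≥ 1 + (a / σ_w²) ∑ b_k B_k`, and `∑ B_k ≥ 1/η_U`. So once `∑ (1 - b_k) B_k < r`,
all eigenvalues of `T` exceed `t = 1 + (a / σ_w²)(1/η_U - r)`, whence `tr T⁻¹ < s / t`
(`mmse_received_lt`). Bound I takes `b_k = Ē_k / (Q μ_E)`, `a = μ_E`; Bound II takes for `b_k` the
indicator of `Ē_k ≥ γ μ_E` divided by `p̄`, and `a = p̄ γ μ_E / Q`.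

What remains is an upper tail for the largest eigenvalue of `∑ ζ_k B_k`, with centred independent
scalars `ζ_k` and fixed matrices `B_k`. The Laplace transform method reduces it to the mean of `tr
exp (θ ∑ ζ_k B_k)`. As `B_k` is fixed, `x B - c B²` is a function of `B`, and the Golden–Thompson
inequality for the summands `L + c B²` and `x B - c B²` suffices: if `E exp (ζ d) ≤ exp (c d²)` at
each eigenvalue `d` of `B`, averaging replaces `ζ B` by `c B²` inside the exponential
(`lintegral_trace_exp_sum_le`). Variances thus add as matrices, without Lieb's concavity theorem.
Since `B_k²` is at most a constant times `G_k` and `∑ G_k = 1`, the total variance does not grow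
with the number of slots. Bennett's scalar estimate supplies `c`, and optimizing `θ` gives `fbt`. -/

namespace EnergyHarvesting

open scoped ComplexOrder

/-! ### Trace inequalities for powers of products -/

section TraceInequalities

variable {n : Type*} [Fintype n]

theorem trace_mul_pow_comm [DecidableEq n] (X Y : Matrix n n ℂ) (m : ℕ) :
    trace ((X * Y) ^ m) = trace ((Y * X) ^ m) := by
  cases m with
  | zero => simp
  | succ m =>
    have h : (X * Y) ^ (m + 1) = X * ((Y * X) ^ m * Y) := by
      induction m with
      | zero => simp
      | succ m ih => rw [pow_succ, ih, pow_succ]; simp only [Matrix.mul_assoc]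
    rw [h, trace_mul_comm, pow_succ, Matrix.mul_assoc]

theorem trace_conjTranspose_mul_self_re (A : Matrix n n ℂ) :
    (trace (Aᴴ * A)).re = ∑ i, ∑ j, ‖A j i‖ ^ 2 := by
  simp only [trace, diag_apply, mul_apply, conjTranspose_apply, Complex.re_sum]
  refine Finset.sum_congr rfl fun i _ => Finset.sum_congr rfl fun j _ => ?_
  rw [← starRingEnd_apply, ← Complex.normSq_eq_conj_mul_self, Complex.ofReal_re,
    Complex.normSq_eq_norm_sq]

theorem trace_conjTranspose_mul_self_re_nonneg (A : Matrix n n ℂ) :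
    0 ≤ (trace (Aᴴ * A)).re := by
  rw [trace_conjTranspose_mul_self_re]; positivity

theorem norm_trace_mul_sq_le (A B : Matrix n n ℂ) :
    ‖trace (A * B)‖ ^ 2 ≤ (trace (Aᴴ * A)).re * (trace (Bᴴ * B)).re := by
  rw [trace_conjTranspose_mul_self_re, trace_conjTranspose_mul_self_re]
  rw [Finset.sum_comm (f := fun i j => ‖A j i‖ ^ 2), ← Fintype.sum_prod_type',
    ← Fintype.sum_prod_type' (f := fun i j => ‖B j i‖ ^ 2)]
  refine le_trans ?_ (Finset.sum_mul_sq_le_sq_mul_sq Finset.univ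
    (fun p : n × n => ‖A p.1 p.2‖) (fun p => ‖B p.2 p.1‖))
  gcongr
  simp only [trace, diag_apply, mul_apply]
  rw [← Fintype.sum_prod_type' (f := fun i j => A i j * B j i)]
  exact (norm_sum_le _ _).trans (by simp)

variable [DecidableEq n]

/-- The two halves need each other in the induction. For the first, apply it to `C ^ 2`; by
cyclicity the bound involves `CᴴC · CCᴴ`, to which the second half applies, the two factors having
equal traces of powers. For the second, apply the first to `P * R` and then the second to `P ^ 2`
and `R ^ 2`. The base case is Cauchy–Schwarz. -/
theorem norm_trace_pow_and_mul_pow_le (k : ℕ) :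
    (∀ C : Matrix n n ℂ, ‖trace (C ^ (2 * 2 ^ k))‖ ≤ (trace ((Cᴴ * C) ^ 2 ^ k)).re) ∧
    (∀ P R : Matrix n n ℂ, P.IsHermitian → R.IsHermitian →
      ‖trace ((P * R) ^ 2 ^ k)‖ ^ 2 ≤
        (trace (P ^ (2 * 2 ^ k))).re * (trace (R ^ (2 * 2 ^ k))).re) := by
  induction k with
  | zero =>
    refine ⟨fun C => ?_, fun P R hP hR => ?_⟩
    · have h := norm_trace_mul_sq_le C C
      rw [← sq (Complex.re _)] at h
      simpa [pow_two] using abs_le_of_sq_le_sq h (trace_conjTranspose_mul_self_re_nonneg C)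
    · have h := norm_trace_mul_sq_le P R
      rw [hP.eq, hR.eq] at h
      simpa [pow_two] using h
  | succ k ih =>
    obtain ⟨hW, hT⟩ := ih
    refine ⟨fun C => ?_, fun P R hP hR => ?_⟩
    · have h1 := hW (C ^ 2)
      have e1 : (C ^ 2) ^ (2 * 2 ^ k) = C ^ (2 * 2 ^ (k + 1)) := by
        rw [← pow_mul]; congr 1; ring
      have e2 : trace (((C ^ 2)ᴴ * C ^ 2) ^ 2 ^ k) = trace ((Cᴴ * C * (C * Cᴴ)) ^ 2 ^ k) := by
        have : (C ^ 2)ᴴ * C ^ 2 = Cᴴ * (Cᴴ * C * C) := by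
          simp only [pow_two, conjTranspose_mul, Matrix.mul_assoc]
        rw [this, trace_mul_pow_comm]
        simp only [Matrix.mul_assoc]
      have h2 := hT (Cᴴ * C) (C * Cᴴ) (isHermitian_conjTranspose_mul_self C)
        (isHermitian_mul_conjTranspose_self C)
      rw [trace_mul_pow_comm C Cᴴ, ← sq] at h2
      have e3 : (2 * 2 ^ k) = 2 ^ (k + 1) := by ring
      -- The exponent is even, so this is a squared Hilbert–Schmidt norm; its sign allows the
      -- squares in `h2` to be removed.
      have h0 : 0 ≤ (trace ((Cᴴ * C) ^ 2 ^ (k + 1))).re := by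
        have := trace_conjTranspose_mul_self_re_nonneg ((Cᴴ * C) ^ 2 ^ k)
        rwa [conjTranspose_pow, (isHermitian_conjTranspose_mul_self C).eq, ← pow_add,
          ← two_mul, e3] at this
      rw [e1, e2] at h1
      refine h1.trans ((Complex.re_le_norm _).trans ?_)
      rw [e3] at h2
      exact (abs_le_of_sq_le_sq h2 h0).trans' (le_abs_self _)
    · have h1 := hW (P * R)
      have e2 : trace (((P * R)ᴴ * (P * R)) ^ 2 ^ k) = trace ((P ^ 2 * R ^ 2) ^ 2 ^ k) := by
        have : (P * R)ᴴ * (P * R) = R * (P ^ 2 * R) := by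
          rw [conjTranspose_mul, hP.eq, hR.eq]; simp only [pow_two, Matrix.mul_assoc]
        rw [this, trace_mul_pow_comm, Matrix.mul_assoc, ← pow_two]
      have h2 := hT (P ^ 2) (R ^ 2) (hP.pow 2) (hR.pow 2)
      rw [← pow_mul, ← pow_mul] at h2
      rw [e2] at h1
      have e3 : (2 * 2 ^ k) = 2 ^ (k + 1) := by ring
      rw [e3] at h1 h2
      refine le_trans ?_ h2
      gcongr
      exact h1.trans (Complex.re_le_norm _)

/-- Cyclically `(XY)ᴴ(XY)` is `X²Y²`, so the first half of the preceding lemma trades a doubling of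
the exponent for a squaring of both factors. -/
theorem norm_trace_mul_pow_two_pow_le (k : ℕ) {X Y : Matrix n n ℂ} (hX : X.IsHermitian)
    (hY : Y.IsHermitian) :
    ‖trace ((X * Y) ^ 2 ^ k)‖ ≤ ‖trace (X ^ 2 ^ k * Y ^ 2 ^ k)‖ := by
  induction k generalizing X Y with
  | zero => simp
  | succ k ih =>
    have h1 := (norm_trace_pow_and_mul_pow_le k).1 (X * Y)
    have e2 : trace (((X * Y)ᴴ * (X * Y)) ^ 2 ^ k) = trace ((X ^ 2 * Y ^ 2) ^ 2 ^ k) := by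
      have : (X * Y)ᴴ * (X * Y) = Y * (X ^ 2 * Y) := by
        rw [conjTranspose_mul, hX.eq, hY.eq]; simp only [pow_two, Matrix.mul_assoc]
      rw [this, trace_mul_pow_comm, Matrix.mul_assoc, ← pow_two]
    have h2 := ih (hX.pow 2) (hY.pow 2)
    have e3 : (2 * 2 ^ k) = 2 ^ (k + 1) := by ring
    rw [← pow_mul, ← pow_mul, e3] at h2
    rw [e2, e3] at h1
    exact h1.trans ((Complex.re_le_norm _).trans h2)

end TraceInequalities

/-! ### The Lie product formula -/

section LieProduct

open NormedSpace Filter Topology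

variable {𝔸 : Type*} [NormedRing 𝔸] [NormOneClass 𝔸]

theorem norm_pow_sub_pow_le {X Y : 𝔸} {K : ℝ} (hK : 1 ≤ K) (hX : ‖X‖ ≤ K) (hY : ‖Y‖ ≤ K)
    (m : ℕ) : ‖X ^ m - Y ^ m‖ ≤ m * K ^ m * ‖X - Y‖ := by
  induction m with
  | zero => simp
  | succ m ih =>
    have e : X ^ (m + 1) - Y ^ (m + 1) = X ^ m * (X - Y) + (X ^ m - Y ^ m) * Y := by
      simp only [pow_succ]; noncomm_ring
    have h1 : ‖X ^ m * (X - Y)‖ ≤ K ^ (m + 1) * ‖X - Y‖ := by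
      refine (norm_mul_le _ _).trans ?_
      gcongr
      exact ((norm_pow_le X m).trans (by gcongr)).trans (pow_le_pow_right₀ hK (Nat.le_succ m))
    have h2 : ‖(X ^ m - Y ^ m) * Y‖ ≤ m * K ^ (m + 1) * ‖X - Y‖ := by
      refine (norm_mul_le _ _).trans ?_
      calc ‖X ^ m - Y ^ m‖ * ‖Y‖ ≤ (m * K ^ m * ‖X - Y‖) * K := by gcongr
        _ = _ := by ring
    rw [e]
    refine (norm_add_le _ _).trans ((add_le_add h1 h2).trans_eq ?_)
    push_cast; ring

variable [NormedAlgebra ℝ 𝔸]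

theorem norm_exp_le_exp_norm (a : 𝔸) : ‖exp a‖ ≤ Real.exp ‖a‖ := by
  rw [exp_eq_tsum ℝ, Real.exp_eq_exp_ℝ, exp_eq_tsum ℝ]
  refine tsum_of_norm_bounded (NormedSpace.expSeries_summable' (𝕂 := ℝ) ‖a‖).hasSum fun i => ?_
  rw [norm_smul, smul_eq_mul, norm_inv, RCLike.norm_natCast]
  gcongr
  exact norm_pow_le a i

/-- The factors `exp (tA) exp (tB)` and `exp (t(A+B))` differ by `o(t)`. At `t = 1/m`, telescoping
the `m`-th powers costs a factor `m`, while the product of the norm bounds stays at `exp (‖A‖ +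
‖B‖)`. -/
theorem tendsto_exp_mul_exp_pow [CompleteSpace 𝔸] (A B : 𝔸) :
    Tendsto (fun m : ℕ => (exp ((m : ℝ)⁻¹ • A) * exp ((m : ℝ)⁻¹ • B)) ^ m) atTop
      (𝓝 (exp (A + B))) := by
  let D : ℝ → 𝔸 := fun t => exp (t • A) * exp (t • B) - exp (t • (A + B))
  have hD : HasDerivAt D 0 0 := by
    have h := ((hasDerivAt_exp_smul_const (𝕂 := ℝ) A 0).mul
      (hasDerivAt_exp_smul_const (𝕂 := ℝ) B 0)).sub
      (hasDerivAt_exp_smul_const (𝕂 := ℝ) (A + B) 0)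
    refine h.congr_deriv ?_
    simp only [zero_smul, exp_zero, one_mul, mul_one, sub_self]
  have hslope := hasDerivAt_iff_tendsto_slope_zero.1 hD
  have hinv : Tendsto (fun m : ℕ => (m : ℝ)⁻¹) atTop (𝓝[≠] 0) := by
    refine tendsto_nhdsWithin_iff.2 ⟨tendsto_inv_atTop_nhds_zero_nat, ?_⟩
    filter_upwards [eventually_gt_atTop 0] with m hm
    simp only [Set.mem_compl_iff, Set.mem_singleton_iff, inv_eq_zero, Nat.cast_eq_zero]
    omega
  have hlim : Tendsto (fun m : ℕ => Real.exp (‖A‖ + ‖B‖) * ‖(m : ℝ) • D (m : ℝ)⁻¹‖) atTop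
      (𝓝 0) := by
    have h := (hslope.comp hinv).norm.const_mul (Real.exp (‖A‖ + ‖B‖))
    have hD0 : D 0 = 0 := by simp [D]
    simpa [Function.comp_def, hD0] using h
  rw [tendsto_iff_norm_sub_tendsto_zero]
  refine squeeze_zero' (Eventually.of_forall fun _ => norm_nonneg _) ?_ hlim
  filter_upwards [eventually_gt_atTop 0] with m hm
  have hm' : (0 : ℝ) < m := by exact_mod_cast hm
  have e : exp (A + B) = exp ((m : ℝ)⁻¹ • (A + B)) ^ m := by
    have : NormedAlgebra ℚ 𝔸 := NormedAlgebra.restrictScalars ℚ ℝ 𝔸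
    rw [← NormedSpace.exp_nsmul, ← Nat.cast_smul_eq_nsmul ℝ, smul_smul, mul_inv_cancel₀ hm'.ne', one_smul]
  have hnorm : ∀ Z : 𝔸, ‖(m : ℝ)⁻¹ • Z‖ = (m : ℝ)⁻¹ * ‖Z‖ := fun Z => by
    rw [norm_smul, Real.norm_of_nonneg (by positivity)]
  have h := norm_pow_sub_pow_le (X := exp ((m : ℝ)⁻¹ • A) * exp ((m : ℝ)⁻¹ • B))
    (Y := exp ((m : ℝ)⁻¹ • (A + B))) (K := Real.exp ((m : ℝ)⁻¹ * (‖A‖ + ‖B‖)))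
    (Real.one_le_exp (by positivity))
    ((norm_mul_le _ _).trans (by
      rw [mul_add, Real.exp_add]
      gcongr <;> exact (norm_exp_le_exp_norm _).trans_eq (by rw [hnorm])))
    ((norm_exp_le_exp_norm _).trans (by rw [hnorm]; gcongr; exact norm_add_le _ _)) m
  rw [e]
  refine h.trans_eq ?_
  rw [← Real.exp_nat_mul, mul_inv_cancel_left₀ hm'.ne', norm_smul, Real.norm_of_nonneg hm'.le]
  simp only [D]
  ring

end LieProduct

/-! ### The Golden–Thompson inequality -/

section GoldenThompson

open NormedSpace Filter Topology

variable {n : Type*} [Fintype n] [DecidableEq n]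

theorem tendsto_matrix_exp_mul_exp_pow [Nonempty n] (A B : Matrix n n ℂ) :
    Tendsto (fun m : ℕ => (exp ((m : ℝ)⁻¹ • A) * exp ((m : ℝ)⁻¹ • B)) ^ m) atTop
      (𝓝 (exp (A + B))) := by
  open scoped Norms.Operator in exact tendsto_exp_mul_exp_pow A B

theorem continuous_matrix_exp : Continuous (exp : Matrix n n ℂ → Matrix n n ℂ) := by
  open scoped Norms.Operator in exact exp_continuous

/-- The **Golden–Thompson inequality**. -/
theorem norm_trace_exp_add_le {A B : Matrix n n ℂ} (hA : A.IsHermitian) (hB : B.IsHermitian) :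
    ‖trace (exp (A + B))‖ ≤ ‖trace (exp A * exp B)‖ := by
  cases isEmpty_or_nonempty n with
  | inl h => simp [trace]
  | inr h =>
    have hlim := ((Continuous.matrix_trace continuous_id).norm.tendsto _).comp
      ((tendsto_matrix_exp_mul_exp_pow A B).comp (tendsto_pow_atTop_atTop_of_one_lt one_lt_two))
    -- Along the exponents `2 ^ k` every term of the Lie product sequence is bounded by the same
    -- number, by the power-trace inequality.
    refine le_of_tendsto' hlim fun k => ?_
    have hpow : ∀ Z : Matrix n n ℂ, exp (((2 ^ k : ℕ) : ℝ)⁻¹ • Z) ^ 2 ^ k = exp Z := fun Z => by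
      rw [← Matrix.exp_nsmul, ← Nat.cast_smul_eq_nsmul ℝ, smul_smul,
        mul_inv_cancel₀ (by positivity), one_smul]
    have hherm : ∀ {Z : Matrix n n ℂ}, Z.IsHermitian →
        (exp (((2 ^ k : ℕ) : ℝ)⁻¹ • Z)).IsHermitian := fun {Z} hZ => by
      refine IsHermitian.exp ?_
      rw [IsHermitian, conjTranspose_smul, hZ.eq, star_trivial]
    have := norm_trace_mul_pow_two_pow_le k (hherm hA) (hherm hB)
    rwa [hpow, hpow] at this

end GoldenThompson

/-! ### Exponentials in an eigenbasis -/

section SpectralExp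

open NormedSpace

variable {n : Type*}

theorem isHermitian_real_smul {A : Matrix n n ℂ} (hA : A.IsHermitian) (a : ℝ) :
    (a • A).IsHermitian := by
  rw [IsHermitian, conjTranspose_smul, hA.eq, star_trivial]

theorem isHermitian_sum_smul {κ : Type*} (S : Finset κ) {B : κ → Matrix n n ℂ}
    (hB : ∀ k, (B k).IsHermitian) (a : κ → ℝ) : (∑ k ∈ S, a k • B k).IsHermitian := by
  rw [IsHermitian, conjTranspose_sum]
  exact Finset.sum_congr rfl fun k _ => isHermitian_real_smul (hB k) (a k)

variable [Fintype n]

theorem sum_norm_diag_eq_norm_trace {M : Matrix n n ℂ} (hM : M.PosSemidef) :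
    ∑ i, ‖M i i‖ = ‖trace M‖ := by
  have h : ∀ i, M i i = (‖M i i‖ : ℂ) := fun i => (Complex.norm_of_nonneg' hM.diag_nonneg).symm
  have : trace M = ((∑ i, ‖M i i‖ : ℝ) : ℂ) := by
    rw [trace]; push_cast; exact Finset.sum_congr rfl fun i _ => h i
  rw [this, Complex.norm_of_nonneg (by positivity)]

variable [DecidableEq n]

theorem exists_unitary_diagonalization {A : Matrix n n ℂ} (hA : A.IsHermitian) :
    ∃ V : Matrix n n ℂ, V * Vᴴ = 1 ∧ Vᴴ * V = 1 ∧
      A = V * diagonal (fun i => (hA.eigenvalues i : ℂ)) * Vᴴ := by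
  refine ⟨hA.eigenvectorUnitary, ?_, ?_, ?_⟩
  · exact Unitary.coe_mul_star_self hA.eigenvectorUnitary
  · exact Unitary.coe_star_mul_self hA.eigenvectorUnitary
  · conv_lhs => rw [hA.spectral_theorem]
    rfl

theorem exp_unitary_conj_diagonal {V : Matrix n n ℂ} (h : V * Vᴴ = 1) (d : n → ℝ) :
    exp (V * diagonal (fun i => (d i : ℂ)) * Vᴴ) =
      V * diagonal (fun i => (Real.exp (d i) : ℂ)) * Vᴴ := by
  have hinv : V⁻¹ = Vᴴ := inv_eq_right_inv h
  have hV : IsUnit V := IsUnit.of_mul_eq_one _ h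
  rw [← hinv, exp_conj _ _ hV, exp_diagonal]
  congr 3
  ext i
  rw [Pi.coe_exp, ← Complex.exp_eq_exp_ℂ, Complex.ofReal_exp]

theorem trace_unitary_conj {V : Matrix n n ℂ} (h : Vᴴ * V = 1) (D : Matrix n n ℂ) :
    trace (V * D * Vᴴ) = trace D := by
  rw [trace_mul_comm, ← Matrix.mul_assoc, h, Matrix.one_mul]

theorem posSemidef_exp {A : Matrix n n ℂ} (hA : A.IsHermitian) : (exp A).PosSemidef := by
  obtain ⟨V, h1, -, h3⟩ := exists_unitary_diagonalization hA
  rw [h3, exp_unitary_conj_diagonal h1]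
  refine PosSemidef.mul_mul_conjTranspose_same (PosSemidef.diagonal fun i => ?_) V
  simp only [Pi.zero_apply]
  exact_mod_cast (Real.exp_pos _).le

theorem sum_norm_diag_conj_eq_norm_trace {M V : Matrix n n ℂ} (hM : M.PosSemidef)
    (hV : V * Vᴴ = 1) : ∑ i, ‖(Vᴴ * M * V) i i‖ = ‖trace M‖ := by
  rw [sum_norm_diag_eq_norm_trace (hM.conjTranspose_mul_mul_same V), trace_mul_comm,
    ← Matrix.mul_assoc, hV, Matrix.one_mul]

/-- Golden–Thompson is applied after adding and subtracting `c • B ^ 2`. The summand `x • B - c • B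
^ 2` is diagonal in the eigenbasis of `B`, so `x` survives only in scalar exponentials, ready to be
averaged independently of `L`. -/
theorem norm_trace_exp_add_smul_le {L B V : Matrix n n ℂ} (hL : L.IsHermitian)
    (hB : B.IsHermitian) (hV : V * Vᴴ = 1) (hV' : Vᴴ * V = 1) {d : n → ℝ}
    (hd : B = V * diagonal (fun i => (d i : ℂ)) * Vᴴ) (x c : ℝ) :
    ‖trace (exp (L + x • B))‖ ≤ ∑ i, Real.exp (x * d i) * (Real.exp (-(c * d i ^ 2)) *
      ‖(Vᴴ * exp (L + c • B ^ 2) * V) i i‖) := by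
  have e1 : x • B - c • B ^ 2 =
      V * diagonal (fun i => ((x * d i - c * d i ^ 2 : ℝ) : ℂ)) * Vᴴ := by
    have e2 : B ^ 2 = V * diagonal (fun i => ((d i ^ 2 : ℝ) : ℂ)) * Vᴴ := by
      have : diagonal (fun i => ((d i ^ 2 : ℝ) : ℂ)) =
          diagonal (fun i => (d i : ℂ)) * diagonal (fun i => (d i : ℂ)) := by
        rw [diagonal_mul_diagonal]; congr; ext i; push_cast; ring
      rw [pow_two, this, hd]
      calc _ = V * diagonal (fun i => (d i : ℂ)) * (Vᴴ * V) * diagonal (fun i => (d i : ℂ)) * Vᴴ := by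
            simp only [Matrix.mul_assoc]
        _ = _ := by rw [hV', Matrix.mul_one]; simp only [Matrix.mul_assoc]
    have : diagonal (fun i => ((x * d i - c * d i ^ 2 : ℝ) : ℂ)) =
        x • diagonal (fun i => (d i : ℂ)) - c • diagonal (fun i => ((d i ^ 2 : ℝ) : ℂ)) := by
      ext i j
      by_cases h : i = j
      · subst h; simp
      · simp [diagonal_apply_ne _ h]
    rw [e2, hd, this]
    simp only [Matrix.mul_sub, Matrix.sub_mul, Matrix.mul_smul, Matrix.smul_mul]
  have hH : (L + c • B ^ 2).IsHermitian := hL.add (isHermitian_real_smul (hB.pow 2) c)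
  have hG := norm_trace_exp_add_le hH
    ((isHermitian_real_smul hB x).sub (isHermitian_real_smul (hB.pow 2) c))
  have e3 : L + c • B ^ 2 + (x • B - c • B ^ 2) = L + x • B := by abel
  rw [e3, e1, exp_unitary_conj_diagonal hV] at hG
  refine hG.trans ?_
  rw [← Matrix.mul_assoc, ← Matrix.mul_assoc, trace_mul_comm, ← Matrix.mul_assoc,
    ← Matrix.mul_assoc]
  refine (norm_sum_le _ _).trans (Finset.sum_le_sum fun i _ => le_of_eq ?_)
  rw [diag_apply, mul_diagonal, norm_mul, Complex.norm_of_nonneg (Real.exp_pos _).le,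
    sub_eq_add_neg, Real.exp_add]
  ring

end SpectralExp

/-! ### Matrix moment generating functions -/

section MatrixMgf

open NormedSpace ENNReal

variable {n : Type*} [Fintype n] [DecidableEq n] {Ω κ : Type*} [MeasurableSpace Ω] [DecidableEq κ]

/-- Subadditivity of matrix cumulants for sums of independent scalar multiples of fixed Hermitian
matrices. -/
theorem lintegral_trace_exp_sum_le (P : Measure Ω) [IsProbabilityMeasure P] {ξ : κ → Ω → ℝ}
    (hξ : ∀ k, Measurable (ξ k))
    (hind : ∀ (S : Finset κ) (k : κ), k ∉ S → IndepFun (fun ω (j : S) => ξ j ω) (ξ k) P)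
    {B : κ → Matrix n n ℂ} (hB : ∀ k, (B k).IsHermitian) (c : κ → ℝ)
    (hmgf : ∀ k i, ∫⁻ ω, ENNReal.ofReal (Real.exp (ξ k ω * (hB k).eigenvalues i)) ∂P ≤
      ENNReal.ofReal (Real.exp (c k * (hB k).eigenvalues i ^ 2)))
    (S : Finset κ) {H : Matrix n n ℂ} (hH : H.IsHermitian) :
    ∫⁻ ω, ENNReal.ofReal ‖trace (exp (H + ∑ k ∈ S, ξ k ω • B k))‖ ∂P ≤
      ENNReal.ofReal ‖trace (exp (H + ∑ k ∈ S, c k • B k ^ 2))‖ := by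
  -- `H` is generalized because each step moves `c k • B k ^ 2` into it.
  induction S using Finset.induction_on generalizing H with
  | empty => simp
  | insert k S hk ih =>
    obtain ⟨V, hV, hV', hd⟩ := exists_unitary_diagonalization (hB k)
    set d := (hB k).eigenvalues
    let M : (S → ℝ) → Matrix n n ℂ := fun a =>
      exp (H + c k • B k ^ 2 + ∑ j : S, a j • B j)
    have hM : Continuous M := by
      refine continuous_matrix_exp.comp (continuous_const.add ?_)
      exact continuous_finsetSum _ fun j _ => (continuous_apply j).smul continuous_const
    have hsum : ∀ ω, ∑ j : S, ξ j ω • B j = ∑ j ∈ S, ξ j ω • B j := fun ω =>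
      Finset.sum_coe_sort S (fun j => ξ j ω • B j)
    -- Positivity makes the norms of the diagonal entries add up exactly to the trace, so returning
    -- from the eigenbasis loses nothing.
    have hMpsd : ∀ ω, (M fun j => ξ j ω).PosSemidef := fun ω => by
      refine posSemidef_exp ((hH.add (isHermitian_real_smul ((hB k).pow 2) _)).add ?_)
      exact isHermitian_sum_smul _ (fun j : S => hB j) _
    let g : n → (S → ℝ) → ℝ≥0∞ := fun i a =>
      ENNReal.ofReal (Real.exp (-(c k * d i ^ 2)) * ‖(Vᴴ * M a * V) i i‖)
    have hg : ∀ i, Measurable (g i) := fun i => by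
      refine ENNReal.measurable_ofReal.comp (Continuous.measurable ?_)
      refine continuous_const.mul (Continuous.norm ?_)
      exact ((continuous_const.matrix_mul hM).matrix_mul continuous_const).matrix_elem i i
    let f : n → ℝ → ℝ≥0∞ := fun i x => ENNReal.ofReal (Real.exp (x * d i))
    have hf : ∀ i, Measurable (f i) := fun i => by fun_prop
    have hξS : Measurable fun ω (j : S) => ξ j ω := measurable_pi_lambda _ fun j => hξ j
    have hstep : ∀ ω, ENNReal.ofReal ‖trace (exp (H + ∑ j ∈ insert k S, ξ j ω • B j))‖ ≤
        ∑ i, f i (ξ k ω) * g i (fun j => ξ j ω) := fun ω => by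
      have hL : (H + ∑ j ∈ S, ξ j ω • B j).IsHermitian :=
        hH.add (isHermitian_sum_smul S hB _)
      have h := norm_trace_exp_add_smul_le hL (hB k) hV hV' hd (ξ k ω) (c k)
      have e1 : H + ∑ j ∈ insert k S, ξ j ω • B j = H + ∑ j ∈ S, ξ j ω • B j + ξ k ω • B k := by
        rw [Finset.sum_insert hk]; abel
      have e2 : exp (H + ∑ j ∈ S, ξ j ω • B j + c k • B k ^ 2) = M fun j => ξ j ω := by
        simp only [M, hsum]; congr 1; abel
      rw [e1]
      refine (ENNReal.ofReal_le_ofReal h).trans_eq ?_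
      rw [ENNReal.ofReal_sum_of_nonneg fun i _ => by positivity]
      refine Finset.sum_congr rfl fun i _ => ?_
      rw [ENNReal.ofReal_mul (Real.exp_pos _).le, e2]
    calc ∫⁻ ω, ENNReal.ofReal ‖trace (exp (H + ∑ j ∈ insert k S, ξ j ω • B j))‖ ∂P
        ≤ ∫⁻ ω, ∑ i, f i (ξ k ω) * g i (fun j => ξ j ω) ∂P := lintegral_mono hstep
      _ = ∑ i, ∫⁻ ω, f i (ξ k ω) * g i (fun j => ξ j ω) ∂P :=
          lintegral_finsetSum _ fun i _ =>
            ((hf i).comp (hξ k)).mul ((hg i).comp hξS)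
      _ = ∑ i, (∫⁻ ω, f i (ξ k ω) ∂P) * ∫⁻ ω, g i (fun j => ξ j ω) ∂P := by
          refine Finset.sum_congr rfl fun i _ => ?_
          exact lintegral_mul_eq_lintegral_mul_lintegral_of_indepFun ((hf i).comp (hξ k))
            ((hg i).comp hξS) ((hind S k hk).symm.comp (hf i) (hg i))
      _ ≤ ∑ i, ENNReal.ofReal (Real.exp (c k * d i ^ 2)) *
            ∫⁻ ω, g i (fun j => ξ j ω) ∂P := by
          gcongr with i
          exact hmgf k i
      _ = ∑ i, ∫⁻ ω, ENNReal.ofReal ‖(Vᴴ * M (fun j => ξ j ω) * V) i i‖ ∂P := by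
          -- The weight `exp (-(c k * d i ^ 2))` inside `g` cancels the bound on the scalar moment
          -- generating function.
          refine Finset.sum_congr rfl fun i _ => ?_
          rw [← lintegral_const_mul' _ _ ENNReal.ofReal_ne_top]
          refine lintegral_congr fun ω => ?_
          simp only [g]
          rw [← ENNReal.ofReal_mul (Real.exp_pos _).le, ← mul_assoc, ← Real.exp_add,
            add_neg_cancel, Real.exp_zero, one_mul]
      _ = ∫⁻ ω, ENNReal.ofReal ‖trace (M fun j => ξ j ω)‖ ∂P := by
          rw [← lintegral_finsetSum]
          · refine lintegral_congr fun ω => ?_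
            rw [← ENNReal.ofReal_sum_of_nonneg fun i _ => norm_nonneg _,
              sum_norm_diag_conj_eq_norm_trace (hMpsd ω) hV]
          · intro i _
            refine ENNReal.measurable_ofReal.comp (Measurable.norm ?_)
            exact (((continuous_const.matrix_mul hM).matrix_mul
              continuous_const).matrix_elem i i).measurable.comp hξS
      _ ≤ ENNReal.ofReal ‖trace (exp (H + ∑ j ∈ insert k S, c j • B j ^ 2))‖ := by
          have h := ih (hH.add (isHermitian_real_smul ((hB k).pow 2) (c k)))
          simp only [M, hsum]
          refine h.trans_eq ?_
          rw [Finset.sum_insert hk, ← add_assoc]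

end MatrixMgf

/-! ### Bennett's scalar estimate -/

section ScalarBounds

/-- The power series are compared term by term: this is the monotonicity of `(e^x - 1 - x) / x²`,
cleared of denominators so that zero needs no separate treatment. -/
theorem sq_mul_exp_sub_le {x X : ℝ} (h : |x| ≤ X) :
    X ^ 2 * (Real.exp x - 1 - x) ≤ x ^ 2 * (Real.exp X - 1 - X) := by
  have hs : ∀ y : ℝ, HasSum (fun m : ℕ => y ^ (m + 2) / (m + 2).factorial)
      (Real.exp y - 1 - y) := fun y => by
    have h := NormedSpace.expSeries_div_hasSum_exp (𝔸 := ℝ) y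
    rw [← Real.exp_eq_exp_ℝ] at h
    have h2 := (hasSum_nat_add_iff' 2).2 h
    simpa [Finset.sum_range_succ, sub_sub] using h2
  refine hasSum_le (fun m => ?_) ((hs x).mul_left (X ^ 2)) ((hs X).mul_left (x ^ 2))
  have hp : x ^ m ≤ X ^ m := (le_abs_self _).trans (by rw [abs_pow]; gcongr)
  calc X ^ 2 * (x ^ (m + 2) / (m + 2).factorial)
      = X ^ 2 * x ^ 2 / (m + 2).factorial * x ^ m := by ring
    _ ≤ X ^ 2 * x ^ 2 / (m + 2).factorial * X ^ m := by gcongr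
    _ = _ := by ring

/-- The coefficient `(e^{θR} - 1 - θR) / R²` in Bennett's bound on moment generating functions. -/
noncomputable def bennettCoeff (R θ : ℝ) : ℝ := (Real.exp (θ * R) - 1 - θ * R) / R ^ 2

theorem bennettCoeff_nonneg (R θ : ℝ) : 0 ≤ bennettCoeff R θ := by
  refine div_nonneg ?_ (sq_nonneg R)
  linarith [Real.add_one_le_exp (θ * R)]

theorem exp_mul_le_bennett {R θ y : ℝ} (hR : 0 < R) (hθ : 0 ≤ θ) (hy : |y| ≤ R) :
    Real.exp (θ * y) ≤ 1 + θ * y + bennettCoeff R θ * y ^ 2 := by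
  rcases hθ.eq_or_lt with rfl | hθ
  · simp [bennettCoeff]
  have h := sq_mul_exp_sub_le (x := θ * y) (X := θ * R)
    (by rw [abs_mul, abs_of_pos hθ]; gcongr)
  have h2 : Real.exp (θ * y) - 1 - θ * y ≤ bennettCoeff R θ * y ^ 2 := by
    rw [bennettCoeff, div_mul_eq_mul_div, le_div_iff₀ (by positivity)]
    have : 0 < θ ^ 2 := by positivity
    refine le_of_mul_le_mul_left ?_ this
    linarith
  linarith

/-- In the quadratic majorant of the exponential the linear term has mean zero; then `1 + u ≤ e^u`.
-/
theorem lintegral_exp_mul_le_bennett {Ω : Type*} [MeasurableSpace Ω] (P : Measure Ω)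
    [IsProbabilityMeasure P] {ζ : Ω → ℝ} (hζ : MemLp ζ 2 P) (hmean : ∫ ω, ζ ω ∂P = 0) {v : ℝ}
    (hvar : ∫ ω, ζ ω ^ 2 ∂P = v) {R θ l : ℝ} (hR : 0 < R) (hθ : 0 ≤ θ)
    (hbd : ∀ᵐ ω ∂P, |ζ ω * l| ≤ R) :
    ∫⁻ ω, ENNReal.ofReal (Real.exp (θ * ζ ω * l)) ∂P ≤
      ENNReal.ofReal (Real.exp (bennettCoeff R θ * v * l ^ 2)) := by
  have hle : ∀ᵐ ω ∂P, Real.exp (θ * ζ ω * l) ≤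
      1 + θ * l * ζ ω + bennettCoeff R θ * l ^ 2 * ζ ω ^ 2 := by
    filter_upwards [hbd] with ω hω
    have := exp_mul_le_bennett hR hθ hω
    rw [← mul_assoc] at this
    linarith
  have hi1 : Integrable (fun ω => θ * l * ζ ω) P := (hζ.integrable one_le_two).const_mul _
  have hi2 : Integrable (fun ω => bennettCoeff R θ * l ^ 2 * ζ ω ^ 2) P :=
    hζ.integrable_sq.const_mul _
  have hi3 : Integrable (fun ω => 1 + θ * l * ζ ω) P := (integrable_const _).add hi1
  calc ∫⁻ ω, ENNReal.ofReal (Real.exp (θ * ζ ω * l)) ∂P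
      ≤ ∫⁻ ω, ENNReal.ofReal (1 + θ * l * ζ ω + bennettCoeff R θ * l ^ 2 * ζ ω ^ 2) ∂P :=
        lintegral_mono_ae (hle.mono fun ω h => ENNReal.ofReal_le_ofReal h)
    _ = ENNReal.ofReal (∫ ω, (1 + θ * l * ζ ω + bennettCoeff R θ * l ^ 2 * ζ ω ^ 2) ∂P) := by
        refine (ofReal_integral_eq_lintegral_ofReal (hi3.add hi2) ?_).symm
        exact hle.mono fun ω h => (Real.exp_pos _).le.trans h
    _ ≤ _ := by
        refine ENNReal.ofReal_le_ofReal ?_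
        rw [integral_add hi3 hi2, integral_add (integrable_const _) hi1, integral_const_mul,
          integral_const_mul, hmean, hvar]
        simp only [integral_const, probReal_univ, smul_eq_mul, mul_one, mul_zero, add_zero]
        linarith [Real.add_one_le_exp (bennettCoeff R θ * v * l ^ 2)]

end ScalarBounds

/-! ### The matrix Bennett inequality -/

section MatrixBennett

open NormedSpace

variable {n : Type*} [Fintype n] [DecidableEq n]

theorem smul_one_sub_eq_conj_diagonal {A V : Matrix n n ℂ} (hV : V * Vᴴ = 1) {d : n → ℝ}
    (hd : A = V * diagonal (fun i => (d i : ℂ)) * Vᴴ) (r : ℝ) :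
    r • (1 : Matrix n n ℂ) - A = V * diagonal (fun i => ((r - d i : ℝ) : ℂ)) * star V := by
  have : diagonal (fun i => ((r - d i : ℝ) : ℂ)) =
      r • (1 : Matrix n n ℂ) - diagonal (fun i => (d i : ℂ)) := by
    ext i j
    by_cases h : i = j
    · subst h; simp
    · simp [h]
  rw [this, hd, Matrix.mul_sub, Matrix.sub_mul, Matrix.mul_smul, Matrix.smul_mul, Matrix.mul_one,
    star_eq_conjTranspose, hV]

theorem posDef_smul_one_sub_iff {A : Matrix n n ℂ} (hA : A.IsHermitian) (r : ℝ) :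
    (r • (1 : Matrix n n ℂ) - A).PosDef ↔ ∀ i, hA.eigenvalues i < r := by
  obtain ⟨V, h1, h2, h3⟩ := exists_unitary_diagonalization hA
  rw [smul_one_sub_eq_conj_diagonal h1 h3,
    Matrix.IsUnit.posDef_star_right_conjugate_iff (IsUnit.of_mul_eq_one _ h1), posDef_diagonal_iff]
  simp only [← Complex.ofReal_zero, Complex.real_lt_real, sub_pos]

theorem posSemidef_smul_one_sub_iff {A : Matrix n n ℂ} (hA : A.IsHermitian) (r : ℝ) :
    (r • (1 : Matrix n n ℂ) - A).PosSemidef ↔ ∀ i, hA.eigenvalues i ≤ r := by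
  obtain ⟨V, h1, h2, h3⟩ := exists_unitary_diagonalization hA
  rw [smul_one_sub_eq_conj_diagonal h1 h3,
    Matrix.IsUnit.posSemidef_star_right_conjugate_iff (IsUnit.of_mul_eq_one _ h1),
    posSemidef_diagonal_iff]
  simp only [← Complex.ofReal_zero, Complex.real_le_real, sub_nonneg]

theorem norm_trace_exp_smul_eq_sum {A : Matrix n n ℂ} (hA : A.IsHermitian) (θ : ℝ) :
    ‖trace (exp (θ • A))‖ = ∑ i, Real.exp (θ * hA.eigenvalues i) := by
  obtain ⟨V, h1, h2, h3⟩ := exists_unitary_diagonalization hA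
  have : θ • A = V * diagonal (fun i => ((θ * hA.eigenvalues i : ℝ) : ℂ)) * Vᴴ := by
    have e : diagonal (fun i => ((θ * hA.eigenvalues i : ℝ) : ℂ)) =
        θ • diagonal (fun i => (hA.eigenvalues i : ℂ)) := by
      ext i j
      by_cases h : i = j
      · subst h; simp
      · simp [h]
    rw [e, Matrix.mul_smul, Matrix.smul_mul, ← h3]
  rw [this, exp_unitary_conj_diagonal h1, trace_unitary_conj h2, trace_diagonal]
  have hnn : 0 ≤ ∑ i, Real.exp (θ * hA.eigenvalues i) :=
    Finset.sum_nonneg fun i _ => (Real.exp_pos _).le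
  rw [← Complex.ofReal_sum, Complex.norm_of_nonneg hnn]

/-- A **matrix Bennett inequality** (before optimization over `θ`) for sums of independent centred
scalar multiples of fixed Hermitian matrices. -/
theorem measure_not_posDef_smul_one_sub_sum_le {Ω κ : Type*} [MeasurableSpace Ω] [Fintype κ]
    [DecidableEq κ] (P : Measure Ω) [IsProbabilityMeasure P] {ζ : κ → Ω → ℝ}
    (hζ : ∀ k, Measurable (ζ k))
    (hind : ∀ (S : Finset κ) (k : κ), k ∉ S → IndepFun (fun ω (j : S) => ζ j ω) (ζ k) P)
    (hL2 : ∀ k, MemLp (ζ k) 2 P) (hmean : ∀ k, ∫ ω, ζ k ω ∂P = 0) {v : ℝ}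
    (hvar : ∀ k, ∫ ω, ζ k ω ^ 2 ∂P = v)
    {B : κ → Matrix n n ℂ} (hB : ∀ k, (B k).IsHermitian) {R ϱ r θ : ℝ} (hR : 0 < R) (hθ : 0 ≤ θ)
    (hbd : ∀ k i, ∀ᵐ ω ∂P, |ζ k ω * (hB k).eigenvalues i| ≤ R)
    (hϱ : (ϱ • (1 : Matrix n n ℂ) - ∑ k, v • B k ^ 2).PosSemidef) :
    P {ω | ¬ (r • (1 : Matrix n n ℂ) - ∑ k, ζ k ω • B k).PosDef} ≤
      ENNReal.ofReal (Fintype.card n * Real.exp (bennettCoeff R θ * ϱ - θ * r)) := by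
  have hmgf := lintegral_trace_exp_sum_le P (ξ := fun k ω => θ * ζ k ω)
    (fun k => (hζ k).const_mul θ)
    (fun S k hk => (hind S k hk).comp (φ := fun a j => θ * a j) (ψ := fun a => θ * a)
      (by fun_prop) (by fun_prop)) hB (fun _ => bennettCoeff R θ * v)
    (fun k i => lintegral_exp_mul_le_bennett P (hL2 k) (hmean k) (hvar k) hR hθ (hbd k i))
    Finset.univ isHermitian_zero
  simp only [zero_add, mul_smul, ← Finset.smul_sum] at hmgf
  have hherm : (∑ k, v • B k ^ 2).IsHermitian :=
    isHermitian_sum_smul _ (fun k => (hB k).pow 2) _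
  -- Only here is the accumulated matrix variance replaced by the scalar `ϱ`.
  have hup : ‖trace (exp (bennettCoeff R θ • ∑ k, v • B k ^ 2))‖ ≤
      Fintype.card n * Real.exp (bennettCoeff R θ * ϱ) := by
    rw [norm_trace_exp_smul_eq_sum hherm, ← nsmul_eq_mul, ← Finset.card_univ]
    refine Finset.sum_le_card_nsmul _ _ _ fun i _ => ?_
    gcongr
    · exact bennettCoeff_nonneg R θ
    · exact (posSemidef_smul_one_sub_iff hherm ϱ).1 hϱ i
  -- On the bad event some eigenvalue is at least `r`, and its exponential alone is a lower bound
  -- for the trace.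
  have hsub : {ω | ¬ (r • (1 : Matrix n n ℂ) - ∑ k, ζ k ω • B k).PosDef} ⊆
      {ω | ENNReal.ofReal (Real.exp (θ * r)) ≤
        ENNReal.ofReal ‖trace (exp (θ • ∑ k, ζ k ω • B k))‖} := by
    intro ω hω
    have hX := isHermitian_sum_smul Finset.univ hB fun k => ζ k ω
    rw [Set.mem_ofPred_eq, posDef_smul_one_sub_iff hX] at hω
    push Not at hω
    obtain ⟨i, hi⟩ := hω
    refine ENNReal.ofReal_le_ofReal ?_
    rw [norm_trace_exp_smul_eq_sum hX]
    refine le_trans ?_ (Finset.single_le_sum (f := fun i => Real.exp (θ * hX.eigenvalues i))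
      (fun i _ => (Real.exp_pos _).le) (Finset.mem_univ i))
    gcongr
  have hmeas : Measurable fun ω => ENNReal.ofReal ‖trace (exp (θ • ∑ k, ζ k ω • B k))‖ := by
    have hc : Continuous fun a : κ → ℝ => ‖trace (exp (θ • ∑ k, a k • B k))‖ := by
      refine ((continuous_matrix_exp.comp ?_).matrix_trace).norm
      exact (continuous_finsetSum _ fun j _ =>
        (continuous_apply j).smul continuous_const).const_smul θ
    exact ENNReal.measurable_ofReal.comp (hc.measurable.comp (measurable_pi_lambda _ hζ))
  have hmarkov := mul_meas_ge_le_lintegral (μ := P) hmeas (ENNReal.ofReal (Real.exp (θ * r)))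
  have h1 : ENNReal.ofReal (Real.exp (θ * r)) *
      P {ω | ¬ (r • (1 : Matrix n n ℂ) - ∑ k, ζ k ω • B k).PosDef} ≤
      ENNReal.ofReal (Fintype.card n * Real.exp (bennettCoeff R θ * ϱ)) :=
    (mul_le_mul_right (measure_mono hsub) _).trans
      (hmarkov.trans (hmgf.trans (ENNReal.ofReal_le_ofReal
        (by simpa only [Finset.smul_sum] using hup))))
  calc P {ω | ¬ (r • (1 : Matrix n n ℂ) - ∑ k, ζ k ω • B k).PosDef}
      = ENNReal.ofReal (Real.exp (-(θ * r))) * (ENNReal.ofReal (Real.exp (θ * r)) *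
        P {ω | ¬ (r • (1 : Matrix n n ℂ) - ∑ k, ζ k ω • B k).PosDef}) := by
        rw [← mul_assoc, ← ENNReal.ofReal_mul (Real.exp_pos _).le, ← Real.exp_add,
          neg_add_cancel, Real.exp_zero, ENNReal.ofReal_one, one_mul]
    _ ≤ ENNReal.ofReal (Real.exp (-(θ * r))) *
        ENNReal.ofReal (Fintype.card n * Real.exp (bennettCoeff R θ * ϱ)) := by gcongr
    _ = _ := by
        rw [← ENNReal.ofReal_mul (Real.exp_pos _).le, sub_eq_add_neg, Real.exp_add]
        congr 1; ring

end MatrixBennett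

/-! ### From Bennett to Bernstein, and the choice of `θ` -/

section BennettBernstein

/-- Both sides vanish at `0`. The derivatives compare through `log (1 + x) ≥ 2x / (x + 2)`; after
cross-multiplication the margin is `x³ / 18`. -/
theorem sq_half_div_le_hfun {a : ℝ} (ha : 0 ≤ a) : a ^ 2 / 2 / (1 + a / 3) ≤ hfun a := by
  let F : ℝ → ℝ := fun x => hfun x - x ^ 2 / 2 / (1 + x / 3)
  have hderiv : ∀ x, 0 ≤ x → HasDerivAt F
      (Real.log (1 + x) - (x * (1 + x / 3) - x ^ 2 / 2 * (1 / 3)) / (1 + x / 3) ^ 2) x := by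
    intro x hx
    have h1 : HasDerivAt (fun x : ℝ => 1 + x) 1 x := (hasDerivAt_id x).const_add 1
    have h2 := (h1.mul (h1.log (by linarith))).sub (hasDerivAt_id x)
    have h3 : HasDerivAt (fun x : ℝ => x ^ 2 / 2) x x :=
      (((hasDerivAt_id x).pow 2).div_const 2).congr_deriv (by simp)
    have h4 : HasDerivAt (fun x : ℝ => 1 + x / 3) (1 / 3) x :=
      ((hasDerivAt_id x).div_const 3).const_add 1
    refine (h2.sub (h3.div h4 (by positivity))).congr_deriv ?_
    have : 1 + x ≠ 0 := by positivity
    field_simp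
    ring
  have hmono : MonotoneOn F (Set.Ici 0) := by
    refine monotoneOn_of_deriv_nonneg (convex_Ici 0)
      (fun x hx => (hderiv x hx).continuousAt.continuousWithinAt)
      (fun x hx => ?_) (fun x hx => ?_) <;> rw [interior_Ici, Set.mem_Ioi] at hx
    · exact (hderiv x hx.le).differentiableAt.differentiableWithinAt
    · rw [(hderiv x hx.le).deriv, sub_nonneg]
      refine le_trans ?_ (Real.le_log_one_add_of_nonneg hx.le)
      rw [div_le_div_iff₀ (by positivity) (by positivity)]
      have : 0 ≤ x ^ 3 := by positivity
      nlinarith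
  have h := hmono Set.self_mem_Ici ha ha
  simp only [F, hfun] at h ⊢
  norm_num at h
  linarith

theorem fbt_le_fbn (s : ℕ) {μ ϱ r : ℝ} (hμ : 0 < μ) (hϱ : 0 ≤ ϱ) (hr : 0 < r) :
    fbt s μ ϱ r ≤ fbn s μ ϱ r := by
  unfold fbt fbn
  split_ifs with h
  · positivity
  · have hϱ' : 0 < ϱ := lt_of_le_of_ne hϱ (Ne.symm h)
    gcongr
    have h1 := sq_half_div_le_hfun (a := μ * r / ϱ) (by positivity)
    have h2 := mul_le_mul_of_nonneg_left h1 (by positivity : 0 ≤ ϱ / μ ^ 2)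
    have e : ϱ / μ ^ 2 * ((μ * r / ϱ) ^ 2 / 2 / (1 + μ * r / ϱ / 3)) =
        r ^ 2 / 2 / (μ * r / 3 + ϱ) := by
      field_simp
      ring
    rw [e] at h2
    rw [neg_mul, neg_div]
    linarith

theorem exists_bennettCoeff_mul_sub_eq {μ ϱ r : ℝ} (hμ : 0 < μ) (hϱ : 0 < ϱ) (hr : 0 < r) :
    ∃ θ, 0 ≤ θ ∧ bennettCoeff μ θ * ϱ - θ * r = -(ϱ / μ ^ 2) * hfun (μ * r / ϱ) := by
  have h1 : 1 ≤ 1 + μ * r / ϱ := by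
    have : 0 < μ * r / ϱ := by positivity
    linarith
  -- The stationary point in `θ`, where `e^{θμ} = 1 + μ r / ϱ`.
  refine ⟨Real.log (1 + μ * r / ϱ) / μ, div_nonneg (Real.log_nonneg h1) hμ.le, ?_⟩
  rw [bennettCoeff, div_mul_cancel₀ _ hμ.ne', Real.exp_log (by linarith), hfun]
  field_simp
  ring

/-- The bound is assumed for all `θ ≥ 0` because no `θ` is optimal at `ϱ = 0`: there `θ → ∞` gives
`0`, the conventional value of `fbt`. -/
theorem le_fbt_of_forall_le {t : ENNReal} {s : ℕ} {μ ϱ r : ℝ} (hμ : 0 < μ) (hϱ : 0 ≤ ϱ)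
    (hr : 0 < r)
    (h : ∀ θ, 0 ≤ θ → t ≤ ENNReal.ofReal (s * Real.exp (bennettCoeff μ θ * ϱ - θ * r))) :
    t ≤ ENNReal.ofReal (fbt s μ ϱ r) := by
  rcases hϱ.eq_or_lt with rfl | hϱ
  · simp only [fbt, if_true, ENNReal.ofReal_zero]
    have hlim : Filter.Tendsto
        (fun θ : ℝ => ENNReal.ofReal (s * Real.exp (bennettCoeff μ θ * 0 - θ * r)))
        Filter.atTop (nhds 0) := by
      rw [← ENNReal.ofReal_zero]
      refine (ENNReal.continuous_ofReal.tendsto _).comp ?_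
      rw [← mul_zero (s : ℝ)]
      refine Filter.Tendsto.const_mul _ ?_
      simp only [mul_zero, zero_sub]
      exact Real.tendsto_exp_neg_atTop_nhds_zero.comp (Filter.tendsto_id.atTop_mul_const hr)
    exact ge_of_tendsto hlim ((Filter.eventually_ge_atTop 0).mono h)
  · obtain ⟨θ, hθ, e⟩ := exists_bennettCoeff_mul_sub_eq hμ hϱ hr
    refine (h θ hθ).trans (ENNReal.ofReal_le_ofReal ?_)
    rw [e, fbt, if_neg hϱ.ne']
    -- The argument yields the factor `s`; the `2 * s` in `fbt` leaves slack.
    have : 0 ≤ (s : ℝ) * Real.exp (-(ϱ / μ ^ 2) * hfun (μ * r / ϱ)) := by positivity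
    linarith

end BennettBernstein

/-! ### The trace of an inverse -/

section TraceInv

variable {n : Type*} [Fintype n] [DecidableEq n]

theorem trace_inv_re_lt [Nonempty n] {T : Matrix n n ℂ} (hT : T.IsHermitian) {t : ℝ} (ht : 0 < t)
    (h : (T - t • (1 : Matrix n n ℂ)).PosDef) :
    (trace T⁻¹).re < Fintype.card n / t := by
  obtain ⟨V, h1, h2, h3⟩ := exists_unitary_diagonalization hT
  set d := hT.eigenvalues
  have e1 : T - t • (1 : Matrix n n ℂ) =
      V * diagonal (fun i => ((d i - t : ℝ) : ℂ)) * star V := by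
    rw [← neg_sub, smul_one_sub_eq_conj_diagonal h1 h3, ← Matrix.neg_mul, ← Matrix.mul_neg,
      diagonal_neg]
    congr; ext i; push_cast; ring
  rw [e1, Matrix.IsUnit.posDef_star_right_conjugate_iff (IsUnit.of_mul_eq_one _ h1),
    posDef_diagonal_iff] at h
  have hd : ∀ i, t < d i := fun i => by
    have := h i
    rw [← Complex.ofReal_zero, Complex.real_lt_real, sub_pos] at this
    exact this
  have e2 : T⁻¹ = V * diagonal (fun i => (((d i)⁻¹ : ℝ) : ℂ)) * Vᴴ := by
    refine inv_eq_right_inv ?_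
    have e3 : diagonal (fun i => (d i : ℂ)) * diagonal (fun i => (((d i)⁻¹ : ℝ) : ℂ)) = 1 := by
      rw [diagonal_mul_diagonal, ← diagonal_one]
      congr; ext i
      rw [← Complex.ofReal_mul, mul_inv_cancel₀ (ht.trans (hd i)).ne', Complex.ofReal_one]
    calc T * (V * diagonal (fun i => (((d i)⁻¹ : ℝ) : ℂ)) * Vᴴ)
        = V * diagonal (fun i => (d i : ℂ)) * (Vᴴ * V) *
            diagonal (fun i => (((d i)⁻¹ : ℝ) : ℂ)) * Vᴴ := by
          conv_lhs => rw [h3]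
          simp only [Matrix.mul_assoc]
      _ = V * (diagonal (fun i => (d i : ℂ)) * diagonal (fun i => (((d i)⁻¹ : ℝ) : ℂ))) * Vᴴ := by
          rw [h2, Matrix.mul_one]; simp only [Matrix.mul_assoc]
      _ = 1 := by rw [e3, Matrix.mul_one, h1]
  rw [e2, trace_unitary_conj h2, trace_diagonal, ← Complex.ofReal_sum, Complex.ofReal_re,
    div_eq_mul_inv, ← nsmul_eq_mul, ← Finset.card_univ, ← Finset.sum_const]
  refine Finset.sum_lt_sum_of_nonempty Finset.univ_nonempty fun i _ => ?_
  exact inv_strictAnti₀ ht (hd i)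

end TraceInv

/-! ### Conditional expectation as best mean-square estimator -/

section CondExp

variable {Ω F : Type*} {m m0 : MeasurableSpace Ω} [NormedAddCommGroup F] [InnerProductSpace ℂ F]

theorem norm_sq_eq_integral_of_ae_eq {μ : Measure Ω} (f : Lp F 2 μ) {g : Ω → F}
    (h : f =ᵐ[μ] g) : ‖f‖ ^ 2 = ∫ ω, ‖g ω‖ ^ 2 ∂μ := by
  have h1 : ((‖f‖ ^ 2 : ℝ) : ℂ) = ((∫ ω, ‖g ω‖ ^ 2 ∂μ : ℝ) : ℂ) := by
    rw [← integral_complex_ofReal]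
    push_cast
    have := inner_self_eq_norm_sq_to_K (𝕜 := ℂ) f
    rw [L2.inner_def] at this
    refine (this.symm.trans ?_)
    refine integral_congr_ae (h.mono fun ω hω => ?_)
    simp only [hω]
    exact_mod_cast inner_self_eq_norm_sq_to_K (𝕜 := ℂ) (g ω)
  exact_mod_cast h1

/-- The conditional expectation minimizes the mean-square error. -/
theorem integral_norm_sub_condExp_sq_le [CompleteSpace F] (μ : Measure Ω) [IsFiniteMeasure μ] (hm : m ≤ m0)
    {x g : Ω → F} (hx : MemLp x 2 μ) (hg : MemLp g 2 μ) (hgm : AEStronglyMeasurable[m] g μ) :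
    ∫ ω, ‖x ω - (μ[x | m]) ω‖ ^ 2 ∂μ ≤ ∫ ω, ‖x ω - g ω‖ ^ 2 ∂μ := by
  have : Fact (m ≤ m0) := ⟨hm⟩
  have hc := hx.condExpL2_ae_eq_condExp (𝕜 := ℂ) hm
  let g' : lpMeas F ℂ m 2 μ := ⟨hg.toLp g, mem_lpMeas_iff_aestronglyMeasurable.2
    (hgm.congr hg.coeFn_toLp.symm)⟩
  -- In `L²` the conditional expectation is the orthogonal projection onto the `m`-measurable
  -- functions.
  have hmin : ‖hx.toLp x - (condExpL2 F ℂ hm (hx.toLp x) : Lp F 2 μ)‖ ≤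
      ‖hx.toLp x - (g' : Lp F 2 μ)‖ := by
    have h := Submodule.starProjection_minimal (U := lpMeas F ℂ m 2 μ) (hx.toLp x)
    have h2 : ⨅ z : lpMeas F ℂ m 2 μ, ‖hx.toLp x - z‖ ≤ ‖hx.toLp x - (g' : Lp F 2 μ)‖ :=
      ciInf_le ⟨0, by rintro _ ⟨z, rfl⟩; exact norm_nonneg _⟩ g'
    rw [← h] at h2
    exact h2
  have h1 := norm_sq_eq_integral_of_ae_eq
    (hx.toLp x - (condExpL2 F ℂ hm (hx.toLp x) : Lp F 2 μ))
    (g := fun ω => x ω - (μ[x | m]) ω) (by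
      filter_upwards [Lp.coeFn_sub (hx.toLp x) (condExpL2 F ℂ hm (hx.toLp x) : Lp F 2 μ),
        hx.coeFn_toLp, hc] with ω h1 h2 h3
      rw [h1, Pi.sub_apply, h2, h3])
  have h2 := norm_sq_eq_integral_of_ae_eq (hx.toLp x - (g' : Lp F 2 μ))
    (g := fun ω => x ω - g ω) (by
      filter_upwards [Lp.coeFn_sub (hx.toLp x) (g' : Lp F 2 μ),
        hx.coeFn_toLp, hg.coeFn_toLp] with ω h1 h2 h3
      rw [h1, Pi.sub_apply, h2, h3])
  rw [← h1, ← h2]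
  gcongr

end CondExp

/-! ### Second moments of linear estimation errors -/

section LinearEstimator

variable {Ω ι : Type*} [MeasurableSpace Ω] [Fintype ι]

theorem memLp_coord {P : Measure Ω} {a : Ω → EuclideanSpace ℂ ι} (ha : MemLp a 2 P) (i : ι) :
    MemLp (fun ω => a ω i) 2 P :=
  (EuclideanSpace.proj i : EuclideanSpace ℂ ι →L[ℂ] ℂ).comp_memLp' ha

theorem integrable_coord_mul_star {P : Measure Ω} {a b : Ω → EuclideanSpace ℂ ι}
    (ha : MemLp a 2 P) (hb : MemLp b 2 P) (i j : ι) :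
    Integrable (fun ω => a ω i * star (b ω j)) P :=
  MemLp.integrable_mul (memLp_coord ha i) (memLp_coord hb j).star

theorem integral_mulVec_mul_star {P : Measure Ω} {a b : Ω → EuclideanSpace ℂ ι}
    (ha : MemLp a 2 P) (hb : MemLp b 2 P) {C : Matrix ι ι ℂ}
    (hC : ∀ i j, ∫ ω, a ω i * star (b ω j) ∂P = C i j) (M N : Matrix ι ι ℂ) (i : ι) :
    Integrable (fun ω => (M *ᵥ (a ω).ofLp) i * star ((N *ᵥ (b ω).ofLp) i)) P ∧
    ∫ ω, (M *ᵥ (a ω).ofLp) i * star ((N *ᵥ (b ω).ofLp) i) ∂P = (M * C * Nᴴ) i i := by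
  have e : ∀ ω, (M *ᵥ (a ω).ofLp) i * star ((N *ᵥ (b ω).ofLp) i) =
      ∑ j, ∑ l, M i j * star (N i l) * (a ω j * star (b ω l)) := fun ω => by
    simp only [mulVec, dotProduct, star_sum, star_mul', Finset.sum_mul_sum]
    refine Finset.sum_congr rfl fun j _ => Finset.sum_congr rfl fun l _ => ?_
    ring
  have hInt : ∀ j l, Integrable (fun ω => M i j * star (N i l) * (a ω j * star (b ω l))) P :=
    fun j l => (integrable_coord_mul_star ha hb j l).const_mul _
  simp only [e]
  refine ⟨integrable_finsetSum _ fun j _ => integrable_finsetSum _ fun l _ => hInt j l, ?_⟩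
  rw [integral_finsetSum _ fun j _ => integrable_finsetSum _ fun l _ => hInt j l]
  simp_rw [integral_finsetSum _ fun l _ => hInt _ l, integral_const_mul, hC]
  rw [Finset.sum_comm]
  simp only [mul_apply, conjTranspose_apply, Finset.sum_mul]
  refine Finset.sum_congr rfl fun j _ => Finset.sum_congr rfl fun l _ => ?_
  ring

theorem integral_norm_sq_mulVec_sub {P : Measure Ω} {x w : Ω → EuclideanSpace ℂ ι}
    (hx : MemLp x 2 P) (hw : MemLp w 2 P) {K W : Matrix ι ι ℂ}
    (hK : ∀ i j, ∫ ω, x ω i * star (x ω j) ∂P = K i j)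
    (hW : ∀ i j, ∫ ω, w ω i * star (w ω j) ∂P = W i j)
    (hxw : ∀ i j, ∫ ω, x ω i * star (w ω j) ∂P = 0) (M L : Matrix ι ι ℂ) :
    ∫ ω, ‖WithLp.toLp 2 (M *ᵥ (x ω).ofLp - L *ᵥ (w ω).ofLp)‖ ^ 2 ∂P =
      (trace (M * K * Mᴴ + L * W * Lᴴ)).re := by
  have hwx : ∀ i j, ∫ ω, w ω i * star (x ω j) ∂P = (0 : Matrix ι ι ℂ) i j := fun i j => by
    have := congrArg star (hxw j i)
    rw [star_zero, ← starRingEnd_apply, ← integral_conj] at this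
    rw [Matrix.zero_apply, ← this]
    refine integral_congr_ae (Filter.Eventually.of_forall fun ω => ?_)
    simp only [starRingEnd_apply, star_mul', star_star]
    ring
  have hterm : ∀ i, Integrable (fun ω => ((‖(M *ᵥ (x ω).ofLp - L *ᵥ (w ω).ofLp) i‖ ^ 2 : ℝ) : ℂ)) P ∧
      ∫ ω, ((‖(M *ᵥ (x ω).ofLp - L *ᵥ (w ω).ofLp) i‖ ^ 2 : ℝ) : ℂ) ∂P =
      (M * K * Mᴴ + L * W * Lᴴ) i i := fun i => by
    obtain ⟨i1, h1⟩ := integral_mulVec_mul_star hx hx hK M M i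
    obtain ⟨i2, h2⟩ := integral_mulVec_mul_star hx hw (C := 0) hxw M L i
    obtain ⟨i3, h3⟩ := integral_mulVec_mul_star hw hx hwx L M i
    obtain ⟨i4, h4⟩ := integral_mulVec_mul_star hw hw hW L L i
    have e : ∀ ω, ((‖(M *ᵥ (x ω).ofLp - L *ᵥ (w ω).ofLp) i‖ ^ 2 : ℝ) : ℂ) =
        (M *ᵥ (x ω).ofLp) i * star ((M *ᵥ (x ω).ofLp) i)
        - (M *ᵥ (x ω).ofLp) i * star ((L *ᵥ (w ω).ofLp) i)
        - (L *ᵥ (w ω).ofLp) i * star ((M *ᵥ (x ω).ofLp) i)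
        + (L *ᵥ (w ω).ofLp) i * star ((L *ᵥ (w ω).ofLp) i) := fun ω => by
      rw [← Complex.normSq_eq_norm_sq, Complex.normSq_eq_conj_mul_self, Pi.sub_apply, map_sub,
        starRingEnd_apply, starRingEnd_apply]
      ring
    simp only [e]
    refine ⟨((i1.sub i2).sub i3).add i4, ?_⟩
    refine (integral_add ((i1.sub i2).sub i3) i4).trans ?_
    rw [integral_sub' (i1.sub i2) i3, integral_sub' i1 i2, h1, h2, h3, h4]
    simp
  have h : ((∫ ω, ‖WithLp.toLp 2 (M *ᵥ (x ω).ofLp - L *ᵥ (w ω).ofLp)‖ ^ 2 ∂P : ℝ) : ℂ) =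
      trace (M * K * Mᴴ + L * W * Lᴴ) := by
    rw [← integral_complex_ofReal]
    simp only [EuclideanSpace.norm_sq_eq, Complex.ofReal_sum]
    rw [integral_finsetSum _ fun i _ => (hterm i).1, trace]
    exact Finset.sum_congr rfl fun i _ => (hterm i).2
  rw [← h, Complex.ofReal_re]

end LinearEstimator

/-! ### The error of the Wiener filter -/

section ErrorCovariance

variable {ι σ : Type*} [Fintype ι] [DecidableEq ι] [Fintype σ] [DecidableEq σ]

/-- Trace of the error covariance of the linear estimator `L`. -/
theorem trace_errorCovariance_eq {U : Matrix ι σ ℂ} (hU : Uᴴ * U = 1) {A : Matrix ι ι ℂ}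
    (hA : A.IsHermitian) {c q : ℝ} (hq : q ≠ 0) {T : Matrix σ σ ℂ}
    (hT : T = 1 + (c / q) • (Uᴴ * (A * A) * U)) (hTu : IsUnit T.det) {L : Matrix ι ι ℂ}
    (hL : L = (c / q) • (U * T⁻¹ * Uᴴ * A)) :
    trace ((1 - L * A) * (c • (U * Uᴴ)) * (1 - L * A)ᴴ + L * (q • (1 : Matrix ι ι ℂ)) * Lᴴ) =
      c * trace T⁻¹ := by
  have hT1 : (c / q) • (Uᴴ * (A * A) * U) = T - 1 := by rw [hT]; abel
  have hTh : T.IsHermitian := by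
    rw [hT]
    refine isHermitian_one.add (isHermitian_real_smul ?_ _)
    rw [IsHermitian, conjTranspose_mul, conjTranspose_mul, conjTranspose_mul,
      conjTranspose_conjTranspose, hA.eq]
    simp only [Matrix.mul_assoc]
  have hTi : T⁻¹ᴴ = T⁻¹ := hTh.inv.eq
  have hcancel : T⁻¹ * T = 1 := nonsing_inv_mul T hTu
  -- The filter shrinks the signal space by `T⁻¹`, because `L * A * U = U * T⁻¹ * (T - 1)`.
  have hMU : (1 - L * A) * U = U * T⁻¹ := by
    have e : L * A * U = U * T⁻¹ * ((c / q) • (Uᴴ * (A * A) * U)) := by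
      rw [hL, Matrix.smul_mul, Matrix.smul_mul, Matrix.mul_smul]
      simp only [Matrix.mul_assoc]
    rw [Matrix.sub_mul, Matrix.one_mul, e, hT1, Matrix.mul_sub, Matrix.mul_assoc, hcancel,
      Matrix.mul_one, Matrix.mul_one]
    abel
  have h1 : (1 - L * A) * (c • (U * Uᴴ)) * (1 - L * A)ᴴ = c • (U * (T⁻¹ * T⁻¹) * Uᴴ) := by
    calc (1 - L * A) * (c • (U * Uᴴ)) * (1 - L * A)ᴴ
        = c • (((1 - L * A) * U) * ((1 - L * A) * U)ᴴ) := by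
          rw [conjTranspose_mul, Matrix.mul_smul, Matrix.smul_mul]
          simp only [Matrix.mul_assoc]
      _ = _ := by
          rw [hMU, conjTranspose_mul, hTi]
          simp only [Matrix.mul_assoc]
  have h2 : L * (q • (1 : Matrix ι ι ℂ)) * Lᴴ = c • (U * (T⁻¹ * (T - 1) * T⁻¹) * Uᴴ) := by
    have hLH : Lᴴ = (c / q) • (A * U * T⁻¹ * Uᴴ) := by
      rw [hL, conjTranspose_smul, star_trivial, conjTranspose_mul, conjTranspose_mul,
        conjTranspose_mul, conjTranspose_conjTranspose, hA.eq, hTi]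
      simp only [Matrix.mul_assoc]
    rw [hLH, ← hT1, hL]
    simp only [Matrix.mul_smul, Matrix.smul_mul, smul_smul, Matrix.mul_one, Matrix.mul_assoc]
    congr 1
    field_simp
  -- The signal part `T⁻²` and the noise part `T⁻¹ - T⁻²` add up to `T⁻¹`.
  have h3 : U * (T⁻¹ * T⁻¹) * Uᴴ + U * (T⁻¹ * (T - 1) * T⁻¹) * Uᴴ = U * T⁻¹ * Uᴴ := by
    rw [← Matrix.add_mul, ← Matrix.mul_add, Matrix.mul_sub, hcancel, Matrix.mul_one,
      Matrix.sub_mul, Matrix.one_mul]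
    congr 2
    abel
  rw [h1, h2, ← smul_add, h3, trace_smul, trace_mul_comm, ← Matrix.mul_assoc, hU, Matrix.one_mul,
    Complex.real_smul]

end ErrorCovariance

/-! ### The MMSE of the received vector -/

section Mmse

variable {NT Q s : ℕ} {Ω : Type*} [MeasurableSpace Ω]

theorem integral_coord_mul_star_eq_zero {ι : Type*} [Fintype ι] {P : Measure Ω}
    {x w : Ω → EuclideanSpace ℂ ι} (hx : Measurable x) (hw : Measurable w)
    (hw0 : ∀ i, ∫ ω, w ω i ∂P = 0) (hxw : IndepFun x w P) (i j : ι) :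
    ∫ ω, x ω i * star (w ω j) ∂P = 0 := by
  have hi : Measurable fun z : EuclideanSpace ℂ ι => z i := by fun_prop
  have hj : Measurable fun z : EuclideanSpace ℂ ι => star (z j) := by fun_prop
  have h := (hxw.comp hi hj).integral_fun_mul_eq_mul_integral
    (hi.comp hx).aestronglyMeasurable (hj.comp hw).aestronglyMeasurable
  simp only [Function.comp_apply] at h
  rw [h]
  have : ∫ ω, star (w ω j) ∂P = 0 := by
    have h2 := integral_conj (μ := P) (f := fun ω => w ω j)
    rw [hw0, map_zero] at h2
    exact h2
  rw [this, mul_zero]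

/-- The conditional expectation does at least as well as the Wiener filter `L`, and an upper bound
is all that the theorem needs. -/
theorem mmse_received_le {P : Measure Ω} [IsProbabilityMeasure P]
    {x w : Ω → EuclideanSpace ℂ (Fin (NT * Q))} {K : Matrix (Fin (NT * Q)) (Fin (NT * Q)) ℂ}
    {U : Matrix (Fin (NT * Q)) (Fin s) ℂ} {Px σw2 : ℝ} (hσ : 0 < σw2)
    (hx : IsProperComplexGaussian P x K)
    (hw : IsProperComplexGaussian P w ((σw2 : ℂ) • (1 : Matrix (Fin (NT * Q)) (Fin (NT * Q)) ℂ)))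
    (hxw : IndepFun x w P) (hK : IsFlatReducedEVD K U Px) {p : Fin NT → ℝ} (hp : ∀ k, 0 ≤ p k)
    {T : Matrix (Fin s) (Fin s) ℂ}
    (hT : T = 1 + (Px / s / σw2) •
      (Uᴴ * diagonal (fun i : Fin (NT * Q) => (p i.divNat : ℂ)) * U)) (hTu : IsUnit T.det) :
    mmse P x (received p x w) ≤ Px / s * (trace T⁻¹).re := by
  set c := Px / s with hc
  set A : Matrix (Fin (NT * Q)) (Fin (NT * Q)) ℂ :=
    diagonal (fun i => (Real.sqrt (p i.divNat) : ℂ)) with hAdef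
  have hA : A.IsHermitian := by
    rw [hAdef, IsHermitian, diagonal_conjTranspose]
    congr; ext i; simp
  have hAA : A * A = diagonal (fun i : Fin (NT * Q) => (p i.divNat : ℂ)) := by
    rw [hAdef, diagonal_mul_diagonal]
    congr; ext i
    rw [← Complex.ofReal_mul, Real.mul_self_sqrt (hp _)]
  rw [← hAA] at hT
  set L : Matrix (Fin (NT * Q)) (Fin (NT * Q)) ℂ := (c / σw2) • (U * T⁻¹ * Uᴴ * A) with hL
  have hKU : K = c • (U * Uᴴ) := by
    have : diagonal (fun _ : Fin s => ((Px / s : ℝ) : ℂ)) = c • (1 : Matrix (Fin s) (Fin s) ℂ) := by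
      ext i j
      by_cases h : i = j
      · subst h; simp [hc]
      · simp [h]
    rw [hK.decomposition, this, Matrix.mul_smul, Matrix.smul_mul, Matrix.mul_one]
  have hx2 := hx.gaussian.memLp_two
  have hw2 := hw.gaussian.memLp_two
  have hyL : ∀ ω, received p x w ω = toEuclideanCLM (𝕜 := ℂ) A (x ω) + w ω := fun ω => by
    ext i
    simp [received, hAdef, mulVec_diagonal]
  have hy2 : MemLp (received p x w) 2 P := by
    have : received p x w = fun ω => toEuclideanCLM (𝕜 := ℂ) A (x ω) + w ω := funext hyL
    rw [this]
    exact ((toEuclideanCLM (𝕜 := ℂ) A).comp_memLp' hx2).add hw2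
  have hym : Measurable (received p x w) := by
    have : received p x w = fun ω => toEuclideanCLM (𝕜 := ℂ) A (x ω) + w ω := funext hyL
    rw [this]
    exact ((toEuclideanCLM (𝕜 := ℂ) A).continuous.measurable.comp hx.measurable).add hw.measurable
  have hg2 : MemLp (fun ω => toEuclideanCLM (𝕜 := ℂ) L (received p x w ω)) 2 P :=
    (toEuclideanCLM (𝕜 := ℂ) L).comp_memLp' hy2
  have hgm : StronglyMeasurable[MeasurableSpace.comap (received p x w) inferInstance]
      (fun ω => toEuclideanCLM (𝕜 := ℂ) L (received p x w ω)) :=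
    ((toEuclideanCLM (𝕜 := ℂ) L).continuous.measurable.comp
      (comap_measurable _)).stronglyMeasurable
  refine (integral_norm_sub_condExp_sq_le P hym.comap_le hx2 hg2
    hgm.aestronglyMeasurable).trans_eq ?_
  have herr : ∀ ω, x ω - toEuclideanCLM (𝕜 := ℂ) L (received p x w ω) =
      WithLp.toLp 2 ((1 - L * A) *ᵥ (x ω).ofLp - L *ᵥ (w ω).ofLp) := fun ω => by
    rw [hyL, map_add]
    ext i
    simp [Matrix.sub_mulVec, mulVec_mulVec]
    ring
  simp only [herr]
  rw [integral_norm_sq_mulVec_sub hx2 hw2 hx.covariance_eq hw.covariance_eq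
    (integral_coord_mul_star_eq_zero hx.measurable hw.measurable hw.mean_eq_zero hxw), hKU]
  have := trace_errorCovariance_eq hK.orthonormal hA hσ.ne' hT hTu hL
  rw [Complex.coe_smul, this, Complex.re_ofReal_mul]

end Mmse

/-! ### The positive semidefinite order -/

section PosSemidefOrder

variable {n : Type*}

theorem posSemidef_real_smul {A : Matrix n n ℂ} (hA : A.PosSemidef) {a : ℝ} (ha : 0 ≤ a) :
    (a • A).PosSemidef := by
  have := hA.smul (show (0 : ℂ) ≤ (a : ℂ) by exact_mod_cast ha)
  rwa [Complex.coe_smul] at this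

theorem posDef_real_smul {A : Matrix n n ℂ} (hA : A.PosDef) {a : ℝ} (ha : 0 < a) :
    (a • A).PosDef := by
  have := hA.smul (show (0 : ℂ) < (a : ℂ) by exact_mod_cast ha)
  rwa [Complex.coe_smul] at this

variable [Fintype n] [DecidableEq n]

/-- With `M = m - G`, which commutes with `G`, one has `GMG + MGM = m (mG - G²)`, and the left side
is visibly positive. -/
theorem posSemidef_smul_sub_sq {G : Matrix n n ℂ} (hG : G.PosSemidef) {m : ℝ} (hm : 0 < m)
    (h : (m • (1 : Matrix n n ℂ) - G).PosSemidef) : (m • G - G ^ 2).PosSemidef := by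
  set M := m • (1 : Matrix n n ℂ) - G with hM
  have h1 := h.mul_mul_conjTranspose_same G
  have h2 := hG.mul_mul_conjTranspose_same M
  rw [hG.isHermitian.eq] at h1
  rw [h.isHermitian.eq] at h2
  have e : m • G - G ^ 2 = m⁻¹ • (G * M * G + M * G * M) := by
    rw [eq_inv_smul_iff₀ hm.ne', hM]
    simp only [Matrix.mul_sub, Matrix.sub_mul, Matrix.mul_smul, Matrix.smul_mul, Matrix.mul_one,
      Matrix.one_mul, smul_sub, pow_two]
    abel
  rw [e]
  exact posSemidef_real_smul (h1.add h2) (inv_nonneg.2 hm.le)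

theorem posSemidef_trace_smul_one_sub {G : Matrix n n ℂ} (hG : G.PosSemidef) {S : ℝ}
    (hS : trace G = (S : ℂ)) : (S • (1 : Matrix n n ℂ) - G).PosSemidef := by
  rw [posSemidef_smul_one_sub_iff hG.isHermitian]
  intro i
  have h := hG.isHermitian.trace_eq_sum_eigenvalues
  rw [hS] at h
  have h' : S = ∑ i, hG.isHermitian.eigenvalues i := by
    rw [← Complex.ofReal_inj, h, Complex.ofReal_sum]
    rfl
  rw [h']
  exact Finset.single_le_sum (fun j _ => hG.eigenvalues_nonneg j) (Finset.mem_univ i)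

end PosSemidefOrder

/-! ### Gram matrices of the slots -/

section SlotGram

variable {NT Q s : ℕ}

/-- The Gram matrix `∑ u_i u_iᴴ` over the epochs `i` of slot `k`. -/
noncomputable def slotGram (U : Matrix (Fin (NT * Q)) (Fin s) ℂ) (k : Fin NT) :
    Matrix (Fin s) (Fin s) ℂ :=
  Uᴴ * diagonal (fun i : Fin (NT * Q) => if i.divNat = k then (1 : ℂ) else 0) * U

/-- The total weight `∑ ‖u_i‖²` over the epochs `i` of slot `k`. -/
noncomputable def slotWeight (U : Matrix (Fin (NT * Q)) (Fin s) ℂ) (k : Fin NT) : ℝ :=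
  ∑ t : Fin Q, ‖uCol U (finProdFinEquiv (k, t))‖ ^ 2

variable {U : Matrix (Fin (NT * Q)) (Fin s) ℂ}

theorem divNat_finProdFinEquiv (k : Fin NT) (t : Fin Q) :
    (finProdFinEquiv (k, t)).divNat = k :=
  congrArg Prod.fst (finProdFinEquiv.symm_apply_apply (k, t))

theorem sum_ite_divNat {M : Type*} [AddCommMonoid M] (f : Fin (NT * Q) → M) (k : Fin NT) :
    ∑ i : Fin (NT * Q), (if i.divNat = k then f i else 0) =
      ∑ t : Fin Q, f (finProdFinEquiv (k, t)) := by
  rw [← finProdFinEquiv.sum_comp, Fintype.sum_prod_type, Finset.sum_eq_single k]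
  · simp [divNat_finProdFinEquiv]
  · intro j _ hj
    simp [divNat_finProdFinEquiv, hj]
  · simp

theorem norm_uCol_sq (i : Fin (NT * Q)) : ‖uCol U i‖ ^ 2 = ∑ j, ‖U i j‖ ^ 2 := by
  rw [EuclideanSpace.norm_sq_eq]
  simp [uCol]

theorem mul_conjTranspose_apply_self (i : Fin (NT * Q)) :
    (U * Uᴴ) i i = ((‖uCol U i‖ ^ 2 : ℝ) : ℂ) := by
  rw [norm_uCol_sq, mul_apply, Complex.ofReal_sum]
  refine Finset.sum_congr rfl fun j _ => ?_
  rw [conjTranspose_apply, ← starRingEnd_apply, Complex.mul_conj, Complex.normSq_eq_norm_sq]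

theorem trace_slotGram (k : Fin NT) : trace (slotGram U k) = (slotWeight U k : ℂ) := by
  rw [slotGram, Matrix.mul_assoc, trace_mul_comm, Matrix.mul_assoc, trace]
  simp only [diag_apply, diagonal_mul, ite_mul, one_mul, zero_mul, mul_conjTranspose_apply_self]
  rw [sum_ite_divNat (fun i => ((‖uCol U i‖ ^ 2 : ℝ) : ℂ)), slotWeight, Complex.ofReal_sum]

theorem posSemidef_slotGram (k : Fin NT) : (slotGram U k).PosSemidef := by
  refine (PosSemidef.diagonal fun i => ?_).conjTranspose_mul_mul_same U
  simp only [Pi.zero_apply]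
  split_ifs <;> simp

theorem sum_smul_slotGram (p : Fin NT → ℝ) :
    ∑ k, p k • slotGram U k =
      Uᴴ * diagonal (fun i : Fin (NT * Q) => (p i.divNat : ℂ)) * U := by
  have : diagonal (fun i : Fin (NT * Q) => (p i.divNat : ℂ)) = ∑ k, p k •
      diagonal (fun i : Fin (NT * Q) => if i.divNat = k then (1 : ℂ) else 0) := by
    ext i j
    rw [Matrix.sum_apply]
    by_cases h : i = j
    · subst h; simp
    · simp [h]
  rw [this, Matrix.mul_sum, Matrix.sum_mul]
  simp only [Matrix.mul_smul, Matrix.smul_mul, slotGram]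

theorem sum_slotGram (hU : Uᴴ * U = 1) : ∑ k, slotGram U k = 1 := by
  have h := sum_smul_slotGram (U := U) (fun _ => 1)
  simpa [hU] using h

theorem posSemidef_one_sub_slotGram (hU : Uᴴ * U = 1) (k : Fin NT) :
    ((1 : ℝ) • (1 : Matrix (Fin s) (Fin s) ℂ) - slotGram U k).PosSemidef := by
  rw [one_smul, ← sum_slotGram hU, ← Finset.sum_erase_eq_sub (Finset.mem_univ k)]
  exact posSemidef_sum _ fun j _ => posSemidef_slotGram j

theorem etaL_le (i : Fin (NT * Q)) : etaL U ≤ ‖uCol U i‖ ^ 2 :=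
  ciInf_le (Set.finite_range _).bddBelow i

theorem le_etaU (i : Fin (NT * Q)) : ‖uCol U i‖ ^ 2 ≤ etaU U :=
  le_ciSup (f := fun i => ‖uCol U i‖ ^ 2) (Set.finite_range _).bddAbove i

theorem mul_etaL_le_slotWeight (k : Fin NT) : Q * etaL U ≤ slotWeight U k := by
  have := Finset.card_nsmul_le_sum Finset.univ
    (fun t : Fin Q => ‖uCol U (finProdFinEquiv (k, t))‖ ^ 2) _ fun t _ => etaL_le _
  simpa [slotWeight] using this

theorem slotWeight_le_mul_etaU (k : Fin NT) : slotWeight U k ≤ Q * etaU U := by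
  have := Finset.sum_le_card_nsmul Finset.univ
    (fun t : Fin Q => ‖uCol U (finProdFinEquiv (k, t))‖ ^ 2) _ fun t _ => le_etaU _
  simpa [slotWeight] using this

/-- An infimum over an empty index type is `0` by convention, so `0 < etaL U` excludes the
degenerate sizes. -/
theorem mul_pos_of_etaL_pos (hη : 0 < etaL U) : 0 < NT * Q := by
  by_contra h
  have h0 : NT * Q = 0 := by omega
  have : IsEmpty (Fin (NT * Q)) := by rw [h0]; infer_instance
  rw [etaL, Real.iInf_of_isEmpty] at hη
  exact hη.false

theorem card_pos_of_etaL_pos (hη : 0 < etaL U) : 0 < s := by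
  rcases Nat.eq_zero_or_pos s with rfl | h
  · have := hη.trans_le (etaL_le ⟨0, mul_pos_of_etaL_pos hη⟩)
    simp [norm_uCol_sq] at this
  · exact h

theorem etaL_le_etaU (hη : 0 < etaL U) : etaL U ≤ etaU U :=
  (etaL_le ⟨0, mul_pos_of_etaL_pos hη⟩).trans (le_etaU _)

/-- The slot Gram matrix normalized to trace `Q`. -/
noncomputable def normalizedSlotGram (U : Matrix (Fin (NT * Q)) (Fin s) ℂ) (k : Fin NT) :
    Matrix (Fin s) (Fin s) ℂ :=
  ((Q : ℝ) / slotWeight U k) • slotGram U k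

theorem slotLength_pos (hη : 0 < etaL U) : (0 : ℝ) < Q := by
  exact_mod_cast Nat.pos_of_mul_pos_left (mul_pos_of_etaL_pos hη)

theorem slotWeight_pos (hη : 0 < etaL U) (k : Fin NT) : 0 < slotWeight U k :=
  (mul_pos (slotLength_pos hη) hη).trans_le (mul_etaL_le_slotWeight k)

theorem div_slotWeight_le (hη : 0 < etaL U) (k : Fin NT) : Q / slotWeight U k ≤ 1 / etaL U := by
  rw [div_le_div_iff₀ (slotWeight_pos hη k) hη, one_mul]
  exact mul_etaL_le_slotWeight k

theorem le_div_slotWeight (hη : 0 < etaL U) (k : Fin NT) : 1 / etaU U ≤ Q / slotWeight U k := by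
  rw [div_le_div_iff₀ (hη.trans_le (etaL_le_etaU hη)) (slotWeight_pos hη k), one_mul]
  exact slotWeight_le_mul_etaU k

theorem posSemidef_normalizedSlotGram (hη : 0 < etaL U) (k : Fin NT) : (normalizedSlotGram U k).PosSemidef :=
  posSemidef_real_smul (posSemidef_slotGram k)
    (div_nonneg (Nat.cast_nonneg Q) (slotWeight_pos hη k).le)

theorem posSemidef_sum_normalizedSlotGram_sub (hη : 0 < etaL U) (hU : Uᴴ * U = 1) :
    (∑ k, normalizedSlotGram U k - (1 / etaU U) • (1 : Matrix (Fin s) (Fin s) ℂ)).PosSemidef := by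
  rw [← sum_slotGram hU, Finset.smul_sum, ← Finset.sum_sub_distrib]
  refine posSemidef_sum _ fun k _ => ?_
  rw [normalizedSlotGram, ← sub_smul]
  exact posSemidef_real_smul (posSemidef_slotGram k) (sub_nonneg.2 (le_div_slotWeight hη k))

/-- Two bounds for the largest eigenvalue: the trace, and `1` because the slot matrices are positive
with sum the identity. They are the source of `min (Q * η_U) 1`. -/
theorem posSemidef_min_smul_one_sub_slotGram (hU : Uᴴ * U = 1) (k : Fin NT) :
    (min (slotWeight U k) 1 • (1 : Matrix (Fin s) (Fin s) ℂ) - slotGram U k).PosSemidef := by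
  rcases min_choice (slotWeight U k) 1 with h | h <;> rw [h]
  · exact posSemidef_trace_smul_one_sub (posSemidef_slotGram k) (trace_slotGram k)
  · exact posSemidef_one_sub_slotGram hU k

theorem eigenvalues_normalizedSlotGram_le (hη : 0 < etaL U) (hU : Uᴴ * U = 1) (k : Fin NT) (i : Fin s) :
    (posSemidef_normalizedSlotGram hη k).isHermitian.eigenvalues i ≤
      1 / etaL U * min (Q * etaU U) 1 := by
  revert i
  rw [← posSemidef_smul_one_sub_iff]
  set m := min (slotWeight U k) 1
  have hq : 0 ≤ Q / slotWeight U k := div_nonneg (Nat.cast_nonneg Q) (slotWeight_pos hη k).le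
  have h1 : Q / slotWeight U k * m ≤ 1 / etaL U * min (Q * etaU U) 1 :=
    mul_le_mul (div_slotWeight_le hη k) (min_le_min_right 1 (slotWeight_le_mul_etaU k))
      (le_min (slotWeight_pos hη k).le zero_le_one) (by positivity)
  have e : (1 / etaL U * min (Q * etaU U) 1) • (1 : Matrix (Fin s) (Fin s) ℂ) -
      normalizedSlotGram U k = ((Q : ℝ) / slotWeight U k) • (m • 1 - slotGram U k) +
      (1 / etaL U * min (Q * etaU U) 1 - Q / slotWeight U k * m) • 1 := by
    rw [normalizedSlotGram, smul_sub, smul_smul, sub_smul]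
    abel
  rw [e]
  exact (posSemidef_real_smul (posSemidef_min_smul_one_sub_slotGram hU k) hq).add
    (posSemidef_real_smul PosSemidef.one (sub_nonneg.2 h1))

/-- Each square is compared with a multiple of its own `slotGram U k`, not of the identity. Since
these matrices sum to the identity, no factor `NT` appears. -/
theorem posSemidef_smul_one_sub_sum_sq (hη : 0 < etaL U) (hU : Uᴴ * U = 1) {v : ℝ} (hv : 0 ≤ v) :
    ((v * (1 / etaL U ^ 2) * min (Q * etaU U) 1) • (1 : Matrix (Fin s) (Fin s) ℂ) -
      ∑ k, v • normalizedSlotGram U k ^ 2).PosSemidef := by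
  rw [← sum_slotGram hU, Finset.smul_sum, ← Finset.sum_sub_distrib]
  refine posSemidef_sum _ fun k _ => ?_
  set m := min (slotWeight U k) 1
  have hm : 0 < m := lt_min (slotWeight_pos hη k) one_pos
  have hq : 0 ≤ Q / slotWeight U k := div_nonneg (Nat.cast_nonneg Q) (slotWeight_pos hη k).le
  have h1 : (Q / slotWeight U k) ^ 2 * m ≤ 1 / etaL U ^ 2 * min (Q * etaU U) 1 := by
    refine mul_le_mul ?_ (min_le_min_right 1 (slotWeight_le_mul_etaU k)) hm.le (by positivity)
    rw [← _root_.one_div_pow]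
    exact pow_le_pow_left₀ hq (div_slotWeight_le hη k) 2
  have e : (v * (1 / etaL U ^ 2) * min (Q * etaU U) 1) • slotGram U k -
      v • normalizedSlotGram U k ^ 2 =
      (v * ((Q : ℝ) / slotWeight U k) ^ 2) • (m • slotGram U k - slotGram U k ^ 2) +
      (v * (1 / etaL U ^ 2 * min (Q * etaU U) 1 - (Q / slotWeight U k) ^ 2 * m)) •
        slotGram U k := by
    rw [normalizedSlotGram, smul_pow, smul_smul, smul_sub, smul_smul, mul_sub, sub_smul]
    simp only [mul_assoc]
    abel
  rw [e]
  exact (posSemidef_real_smul (posSemidef_smul_sub_sq (posSemidef_slotGram k) hm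
    (posSemidef_min_smul_one_sub_slotGram hU k)) (by positivity)).add
    (posSemidef_real_smul (posSemidef_slotGram k) (mul_nonneg hv (sub_nonneg.2 h1)))

end SlotGram

/-! ### From the matrix tail to the error tail -/

section ErrorBound

variable {NT Q s : ℕ} {Ω : Type*} [MeasurableSpace Ω] {P : Measure Ω}
  {x w : Ω → EuclideanSpace ℂ (Fin (NT * Q))} {K : Matrix (Fin (NT * Q)) (Fin (NT * Q)) ℂ}
  {U : Matrix (Fin (NT * Q)) (Fin s) ℂ} {Px σw2 : ℝ}

theorem covariance_apply_self (hK : IsFlatReducedEVD K U Px) (i : Fin (NT * Q)) :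
    K i i = ((Px / s * ‖uCol U i‖ ^ 2 : ℝ) : ℂ) := by
  rw [hK.decomposition, Complex.ofReal_mul, ← mul_conjTranspose_apply_self, mul_apply, mul_apply,
    Finset.mul_sum]
  refine Finset.sum_congr rfl fun j _ => ?_
  rw [mul_diagonal]
  ring

theorem integral_norm_coord_sq (hx : IsProperComplexGaussian P x K)
    (hK : IsFlatReducedEVD K U Px) (i : Fin (NT * Q)) :
    ∫ ω, ‖x ω i‖ ^ 2 ∂P = Px / s * ‖uCol U i‖ ^ 2 := by
  rw [← Complex.ofReal_inj, ← covariance_apply_self hK, ← hx.covariance_eq,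
    ← integral_complex_ofReal]
  refine integral_congr_ae (Filter.Eventually.of_forall fun ω => ?_)
  simp only
  rw [← Complex.normSq_eq_norm_sq, ← Complex.mul_conj, starRingEnd_apply]

variable [IsProbabilityMeasure P]

theorem txEnergy_eq (hx : IsProperComplexGaussian P x K) (hK : IsFlatReducedEVD K U Px) {p : ℝ}
    (hp : 0 ≤ p) (k : Fin NT) :
    txEnergy P x p k = p * (Px / s * slotWeight U k) := by
  have h2 := hx.gaussian.memLp_two
  have e : ∀ ω, ‖(Real.sqrt p : ℂ) • buffer (x ω) k‖ ^ 2 =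
      p * ∑ t : Fin Q, ‖x ω (finProdFinEquiv (k, t))‖ ^ 2 := fun ω => by
    rw [norm_smul, mul_pow, Complex.norm_of_nonneg (Real.sqrt_nonneg p), Real.sq_sqrt hp,
      EuclideanSpace.norm_sq_eq]
    rfl
  simp only [txEnergy, e]
  rw [integral_const_mul,
    integral_finsetSum _ fun t _ => (memLp_coord h2 _).integrable_norm_pow', slotWeight]
  simp only [integral_norm_coord_sq hx hK, Finset.mul_sum]

theorem mmse_received_lt (hPx : 0 < Px) (hσ : 0 < σw2) (hx : IsProperComplexGaussian P x K)
    (hw : IsProperComplexGaussian P w ((σw2 : ℂ) • (1 : Matrix (Fin (NT * Q)) (Fin (NT * Q)) ℂ)))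
    (hxw : IndepFun x w P) (hK : IsFlatReducedEVD K U Px) (hη : 0 < etaL U) {p e b : Fin NT → ℝ}
    (hp : ∀ k, 0 ≤ p k ∧ txEnergy P x (p k) k = e k) {a r : ℝ} (ha : 0 < a)
    (hr : r ≤ 1 / etaU U) (heb : ∀ k, a * b k * Q ≤ e k)
    (hpos : (r • (1 : Matrix (Fin s) (Fin s) ℂ) -
      ∑ k, (1 - b k) • normalizedSlotGram U k).PosDef) :
    mmse P x (received p x w) < 1 / (1 + 1 / σw2 * a * (1 / etaU U - r)) * Px := by
  have hs : (0 : ℝ) < s := by exact_mod_cast card_pos_of_etaL_pos hη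
  have : Nonempty (Fin s) := ⟨⟨0, card_pos_of_etaL_pos hη⟩⟩
  set T : Matrix (Fin s) (Fin s) ℂ := 1 + (Px / s / σw2) •
      (Uᴴ * diagonal (fun i : Fin (NT * Q) => (p i.divNat : ℂ)) * U) with hT
  set t : ℝ := 1 + 1 / σw2 * a * (1 / etaU U - r) with ht
  have htpos : 0 < t := by
    have : 0 ≤ 1 / σw2 * a * (1 / etaU U - r) :=
      mul_nonneg (by positivity) (sub_nonneg.2 hr)
    linarith
  have hpe : ∀ k, Px / s * p k = e k / slotWeight U k := fun k => by
    rw [eq_div_iff (slotWeight_pos hη k).ne', ← (hp k).2, txEnergy_eq hx hK (hp k).1]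
    ring
  -- Three contributions: the energy in excess of `a * b k * Q`, the deviation controlled by `hpos`,
  -- and the excess of `∑ B_k` over `1 / η_U`. The first and third are positive semidefinite, the
  -- second positive definite.
  have hTsub : T - t • (1 : Matrix (Fin s) (Fin s) ℂ) = (1 / σw2) •
      (∑ k, ((e k - a * b k * Q) / slotWeight U k) • slotGram U k +
        a • ((r • 1 - ∑ k, (1 - b k) • normalizedSlotGram U k) +
          (∑ k, normalizedSlotGram U k - (1 / etaU U) • 1))) := by
    have e1 : (Px / s / σw2) • (Uᴴ * diagonal (fun i : Fin (NT * Q) => (p i.divNat : ℂ)) * U) =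
        (1 / σw2) • ∑ k, (e k / slotWeight U k) • slotGram U k := by
      rw [← sum_smul_slotGram, Finset.smul_sum, Finset.smul_sum]
      refine Finset.sum_congr rfl fun k _ => ?_
      rw [← hpe, smul_smul, smul_smul]
      congr 1; ring
    have e2 : ∑ k, (1 - b k) • normalizedSlotGram U k =
        ∑ k, normalizedSlotGram U k - ∑ k, b k • normalizedSlotGram U k := by
      simp only [sub_smul, one_smul, Finset.sum_sub_distrib]
    have e3 : ∑ k, ((e k - a * b k * Q) / slotWeight U k) • slotGram U k =
        ∑ k, (e k / slotWeight U k) • slotGram U k -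
          a • ∑ k, b k • normalizedSlotGram U k := by
      rw [Finset.smul_sum, ← Finset.sum_sub_distrib]
      refine Finset.sum_congr rfl fun k _ => ?_
      rw [normalizedSlotGram, smul_smul, smul_smul, ← sub_smul]
      congr 1; ring
    rw [hT, e1, e2, e3, ht]
    module
  have hTpos : (T - t • (1 : Matrix (Fin s) (Fin s) ℂ)).PosDef := by
    rw [hTsub]
    refine posDef_real_smul (PosDef.posSemidef_add (posSemidef_sum _ fun k _ => ?_)
      (posDef_real_smul (hpos.add_posSemidef
        (posSemidef_sum_normalizedSlotGram_sub hη hK.orthonormal)) ha)) (by positivity)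
    exact posSemidef_real_smul (posSemidef_slotGram k)
      (div_nonneg (sub_nonneg.2 (heb k)) (slotWeight_pos hη k).le)
  have hTpd : T.PosDef := by
    have := hTpos.add (posDef_real_smul (PosDef.one (n := Fin s) (R := ℂ)) htpos)
    rwa [sub_add_cancel] at this
  have h1 := mmse_received_le hσ hx hw hxw hK (fun k => (hp k).1) hT
    ((Matrix.isUnit_iff_isUnit_det _).1 hTpd.isUnit)
  have h2 := trace_inv_re_lt hTpd.isHermitian htpos hTpos
  rw [Fintype.card_fin] at h2
  calc mmse P x (received p x w) ≤ Px / s * (trace T⁻¹).re := h1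
    _ < Px / s * (s / t) := by gcongr
    _ = 1 / t * Px := by field_simp

variable {ΩE : Type*} [MeasurableSpace ΩE] {PE : Measure ΩE} [IsProbabilityMeasure PE]

/-- Tail bound for the error when the normalized slot energies dominate independent variables `b`
of mean one. -/
theorem one_sub_fbt_le_measureReal_mmse_lt (hPx : 0 < Px) (hσ : 0 < σw2)
    (hx : IsProperComplexGaussian P x K)
    (hw : IsProperComplexGaussian P w ((σw2 : ℂ) • (1 : Matrix (Fin (NT * Q)) (Fin (NT * Q)) ℂ)))
    (hxw : IndepFun x w P) (hK : IsFlatReducedEVD K U Px) (hη : 0 < etaL U)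
    {E : Fin (NT * Q) → ΩE → ℝ} {p : ΩE → Fin NT → ℝ}
    (hp : ∀ᵐ ω ∂PE, ∀ k, 0 ≤ p ω k ∧ txEnergy P x (p ω k) k = slotEnergy E k ω)
    {b : Fin NT → ΩE → ℝ} (hb : ∀ k, Measurable (b k))
    (hind : ∀ (S : Finset (Fin NT)) (k : Fin NT), k ∉ S →
      IndepFun (fun ω (j : S) => b j ω) (b k) PE)
    (hmean : ∀ k, ∫ ω, b k ω ∂PE = 1) {v : ℝ} (hvar : ∀ k, ∫ ω, (1 - b k ω) ^ 2 ∂PE = v)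
    (hv : 0 ≤ v) {R a r : ℝ} (hR : 0 < R) (hbd : ∀ k, ∀ᵐ ω ∂PE, |1 - b k ω| ≤ R) (ha : 0 < a)
    (hEb : ∀ k, ∀ᵐ ω ∂PE, a * b k ω * Q ≤ slotEnergy E k ω) (hr : r ∈ Set.Ioc 0 (1 / etaU U)) :
    1 - fbt s (1 / etaL U * R * min (Q * etaU U) 1)
      (v * (1 / etaL U ^ 2) * min (Q * etaU U) 1) r ≤
    PE.real {ω | mmse P x (received (p ω) x w) <
      1 / (1 + 1 / σw2 * a * (1 / etaU U - r)) * Px} := by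
  have hηU : 0 < etaU U := hη.trans_le (etaL_le_etaU hη)
  have hmin : 0 < min (Q * etaU U) 1 := lt_min (mul_pos (slotLength_pos hη) hηU) one_pos
  have hμ : 0 < 1 / etaL U * R * min (Q * etaU U) 1 := by positivity
  have hL2 : ∀ k, MemLp (fun ω => 1 - b k ω) 2 PE := fun k =>
    MemLp.of_bound (measurable_const.sub (hb k)).aestronglyMeasurable R (hbd k)
  have hbint : ∀ k, Integrable (b k) PE := fun k => by
    have h := (integrable_const (1 : ℝ)).sub ((hL2 k).integrable one_le_two)
    exact h.congr (Filter.Eventually.of_forall fun ω => sub_sub_cancel 1 (b k ω))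
  have hbad : PE {ω | ¬ (r • (1 : Matrix (Fin s) (Fin s) ℂ) -
      ∑ k, (1 - b k ω) • normalizedSlotGram U k).PosDef} ≤
      ENNReal.ofReal (fbt s (1 / etaL U * R * min (Q * etaU U) 1)
        (v * (1 / etaL U ^ 2) * min (Q * etaU U) 1) r) := by
    refine le_fbt_of_forall_le hμ (by positivity) hr.1 fun θ hθ => ?_
    have h := measure_not_posDef_smul_one_sub_sum_le PE (ζ := fun k ω => 1 - b k ω)
      (fun k => measurable_const.sub (hb k))
      (fun S k hk => (hind S k hk).comp (φ := fun (c : S → ℝ) (j : S) => 1 - c j)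
        (ψ := fun c : ℝ => 1 - c)
        (by fun_prop) (by fun_prop)) hL2
      (fun k => by rw [integral_sub (integrable_const _) (hbint k), hmean]; simp) hvar
      (fun k => (posSemidef_normalizedSlotGram hη k).isHermitian) (r := r) hμ hθ
      (fun k i => by
        filter_upwards [hbd k] with ω hω
        rw [abs_mul, abs_of_nonneg ((posSemidef_normalizedSlotGram hη k).eigenvalues_nonneg i)]
        refine (mul_le_mul hω (eigenvalues_normalizedSlotGram_le hη hK.orthonormal k i)
          ((posSemidef_normalizedSlotGram hη k).eigenvalues_nonneg i) hR.le).trans_eq ?_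
        ring)
      (posSemidef_smul_one_sub_sum_sq hη hK.orthonormal hv)
    rwa [Fintype.card_fin] at h
  set A := {ω | mmse P x (received (p ω) x w) <
      1 / (1 + 1 / σw2 * a * (1 / etaU U - r)) * Px} with hA
  have hle : PE Aᶜ ≤ ENNReal.ofReal (fbt s (1 / etaL U * R * min (Q * etaU U) 1)
      (v * (1 / etaL U ^ 2) * min (Q * etaU U) 1) r) := by
    refine le_trans (measure_mono_ae ?_) hbad
    filter_upwards [hp, ae_all_iff.2 hEb] with ω h1 h2 hω
    refine fun h3 => hω ?_
    exact mmse_received_lt hPx hσ hx hw hxw hK hη h1 ha hr.2 h2 h3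
  have hfbt : 0 ≤ fbt s (1 / etaL U * R * min (Q * etaU U) 1)
      (v * (1 / etaL U ^ 2) * min (Q * etaU U) 1) r := by
    unfold fbt
    split_ifs
    · exact le_rfl
    · positivity
  have h1 : PE.real Aᶜ ≤ _ := ENNReal.toReal_le_of_le_ofReal hfbt hle
  -- Subadditivity replaces the complement rule, so measurability of `A` is not needed.
  have h2 := measureReal_union_le (μ := PE) A Aᶜ
  rw [Set.union_compl_self, probReal_univ] at h2
  linarith

end ErrorBound

/-! ### Independence and common law of the slot energies -/

section SlotEnergy

variable {NT Q : ℕ} {Ω : Type*} [MeasurableSpace Ω] {P : Measure Ω}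
  {E : Fin (NT * Q) → Ω → ℝ}

theorem measurable_slotEnergy (hE : ∀ t, Measurable (E t)) (k : Fin NT) :
    Measurable (slotEnergy E k) :=
  Finset.measurable_fun_sum _ fun _ _ => hE _

theorem indepFun_slotEnergy (hE : ∀ t, Measurable (E t)) (hind : iIndepFun E P)
    (S : Finset (Fin NT)) (k : Fin NT) (hk : k ∉ S) :
    IndepFun (fun ω (j : S) => slotEnergy E j ω) (slotEnergy E k) P := by
  have hind' := hind.precomp (finProdFinEquiv (m := NT) (n := Q)).injective
  have hdisj : Disjoint (S ×ˢ (Finset.univ : Finset (Fin Q))) ({k} ×ˢ Finset.univ) := by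
    rw [Finset.disjoint_left]
    rintro ⟨j, t⟩ h1 h2
    simp only [Finset.mem_product, Finset.mem_singleton, Finset.mem_univ, and_true] at h1 h2
    exact hk (h2 ▸ h1)
  have h := hind'.indepFun_finset _ _ hdisj fun i => hE _
  let φ : (↥(S ×ˢ (Finset.univ : Finset (Fin Q))) → ℝ) → S → ℝ :=
    fun a j => ∑ t : Fin Q, a ⟨(j, t), by simp⟩
  let ψ : (↥(({k} : Finset (Fin NT)) ×ˢ (Finset.univ : Finset (Fin Q))) → ℝ) → ℝ :=
    fun a => ∑ t : Fin Q, a ⟨(k, t), by simp⟩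
  have hφ : Measurable φ := by fun_prop
  have hψ : Measurable ψ := by fun_prop
  exact h.comp hφ hψ

theorem identDistrib_slotEnergy (hind : iIndepFun E P)
    (hid : ∀ t t', IdentDistrib (E t) (E t') P P) (k k' : Fin NT) :
    IdentDistrib (slotEnergy E k) (slotEnergy E k') P P := by
  have hinj : ∀ k : Fin NT, Function.Injective fun t : Fin Q => finProdFinEquiv (k, t) :=
    fun k t t' h => (Prod.ext_iff.1 (finProdFinEquiv.injective h)).2
  have h := IdentDistrib.pi (fun t : Fin Q => hid (finProdFinEquiv (k, t)) (finProdFinEquiv (k', t)))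
    (hind.precomp (hinj k)) (hind.precomp (hinj k'))
  exact h.comp (u := fun a : Fin Q → ℝ => ∑ t, a t) (by fun_prop)

end SlotEnergy

/-! ### Range, mean and variance of the slot energies -/

section EnergyArrivals

variable {NT Q : ℕ} {Ω : Type*} [MeasurableSpace Ω] {P : Measure Ω}
  {E : Fin (NT * Q) → Ω → ℝ} {μE ϱE rE : ℝ}

theorem slotEnergy_bounds (hbd : ∀ t, ∀ᵐ ω ∂P, 0 ≤ E t ω ∧ E t ω ≤ rE * μE) (k : Fin NT) :
    ∀ᵐ ω ∂P, 0 ≤ slotEnergy E k ω ∧ slotEnergy E k ω ≤ Q * (rE * μE) := by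
  filter_upwards [ae_all_iff.2 hbd] with ω hω
  refine ⟨Finset.sum_nonneg fun t _ => (hω _).1, ?_⟩
  have := Finset.sum_le_card_nsmul Finset.univ
    (fun t : Fin Q => E (finProdFinEquiv (k, t)) ω) _ fun t _ => (hω _).2
  simpa [slotEnergy] using this

theorem memLp_arrival [IsProbabilityMeasure P] (hE : ∀ t, Measurable (E t))
    (hbd : ∀ t, ∀ᵐ ω ∂P, 0 ≤ E t ω ∧ E t ω ≤ rE * μE) (t : Fin (NT * Q)) : MemLp (E t) 2 P :=
  MemLp.of_bound (hE t).aestronglyMeasurable (rE * μE) ((hbd t).mono fun ω h => by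
    rw [Real.norm_of_nonneg h.1]; exact h.2)

theorem integral_slotEnergy (hInt : ∀ t, Integrable (E t) P)
    (hmean : ∀ t, ∫ ω, E t ω ∂P = μE) (k : Fin NT) : ∫ ω, slotEnergy E k ω ∂P = Q * μE := by
  simp only [slotEnergy]
  rw [integral_finsetSum _ fun t _ => hInt _]
  simp [hmean]

theorem variance_slotEnergy (hL2 : ∀ t, MemLp (E t) 2 P) (hind : iIndepFun E P)
    (hvar : ∀ t, Var[E t; P] = ϱE) (k : Fin NT) : Var[slotEnergy E k; P] = Q * ϱE := by
  have h := IndepFun.variance_sum (μ := P) (X := fun t : Fin Q => E (finProdFinEquiv (k, t)))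
    (s := Finset.univ) (fun t _ => hL2 _) (fun t _ t' _ htt' => hind.indepFun fun h =>
      htt' (Prod.ext_iff.1 (finProdFinEquiv.injective h)).2)
  have e : slotEnergy E k = ∑ t : Fin Q, E (finProdFinEquiv (k, t)) := by
    ext ω; simp [slotEnergy]
  rw [e, h]
  simp [hvar]

end EnergyArrivals

end EnergyHarvesting

/-! ### The two bounds -/

theorem theorem3p1 {NT Q s : ℕ}
    -- signal and channel noise
    {ΩS : Type*} [MeasurableSpace ΩS] (PS : Measure ΩS) [IsProbabilityMeasure PS]
    (x w : ΩS → EuclideanSpace ℂ (Fin (NT * Q)))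
    (K : Matrix (Fin (NT * Q)) (Fin (NT * Q)) ℂ) (U : Matrix (Fin (NT * Q)) (Fin s) ℂ)
    (Px σw2 : ℝ) (hPx : 0 < Px) (hσ : 0 < σw2)
    (hx : IsProperComplexGaussian PS x K)
    (hw : IsProperComplexGaussian PS w ((σw2 : ℂ) • (1 : Matrix (Fin (NT * Q)) (Fin (NT * Q)) ℂ)))
    (hxw : IndepFun x w PS)
    (hK : IsFlatReducedEVD K U Px)
    (hη : 0 < etaL U)
    -- energy arrivals
    {ΩE : Type*} [MeasurableSpace ΩE] (PE : Measure ΩE) [IsProbabilityMeasure PE]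
    (E : Fin (NT * Q) → ΩE → ℝ) (μE ϱE rE : ℝ)
    (hEmeas : ∀ t, Measurable (E t))
    (hEindep : iIndepFun E PE)
    (hEident : ∀ t t', IdentDistrib (E t) (E t') PE PE)
    (hEmean : ∀ t, ∫ ω, E t ω ∂PE = μE)
    (hEvar : ∀ t, Var[E t; PE] = ϱE)
    (hμE : 0 < μE) (hrE : 1 ≤ rE)
    (hEbound : ∀ t, ∀ᵐ ω ∂PE, 0 ≤ E t ω ∧ E t ω ≤ rE * μE)
    -- amplification factors: all the energy in the battery is used in every slot
    (p : ΩE → Fin NT → ℝ)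
    (hp : ∀ᵐ ω ∂PE, ∀ k, 0 ≤ p ω k ∧ txEnergy PS x (p ω k) k = slotEnergy E k ω) :
    (∀ r ∈ Set.Ioc 0 (1 / etaU U),
      PE.real {ω | mmse PS x (received (p ω) x w) < errI Px σw2 μE (etaU U) r}
          ≥ 1 - fbt s (muI Q (etaL U) (etaU U) rE) (rhoI Q (etaL U) (etaU U) μE ϱE) r ∧
        1 - fbt s (muI Q (etaL U) (etaU U) rE) (rhoI Q (etaL U) (etaU U) μE ϱE) r
          ≥ 1 - fbn s (muI Q (etaL U) (etaU U) rE) (rhoI Q (etaL U) (etaU U) μE ϱE) r) ∧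
    (∀ γ ∈ Set.Ioc 0 (Q * rE), ∀ k : Fin NT, ∀ pbar : ℝ,
      pbar = PE.real {ω | slotEnergy E k ω ≥ γ * μE} → 0 < pbar →
      ∀ r ∈ Set.Ioc 0 (1 / etaU U),
      PE.real {ω | mmse PS x (received (p ω) x w) < errII Q Px σw2 μE (etaU U) γ pbar r}
          ≥ 1 - fbt s (muII Q (etaL U) (etaU U) pbar) (rhoII Q (etaL U) (etaU U) pbar) r ∧
        1 - fbt s (muII Q (etaL U) (etaU U) pbar) (rhoII Q (etaL U) (etaU U) pbar) r
          ≥ 1 - fbn s (muII Q (etaL U) (etaU U) pbar) (rhoII Q (etaL U) (etaU U) pbar) r) := by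
  have hηU : 0 < etaU U := hη.trans_le (etaL_le_etaU hη)
  have hQ : (0 : ℝ) < Q := slotLength_pos hη
  have hmin : 0 < min (Q * etaU U) 1 := lt_min (mul_pos hQ hηU) one_pos
  have hL2 := memLp_arrival hEmeas hEbound
  have hSm := measurable_slotEnergy (NT := NT) (Q := Q) hEmeas
  have hSind := indepFun_slotEnergy hEmeas hEindep
  refine ⟨fun r hr => ?_, fun γ hγ k₀ pbar hpbar hpos r hr => ?_⟩
  · have hϱE : 0 ≤ ϱE := by
      rw [← hEvar ⟨0, mul_pos_of_etaL_pos hη⟩]; exact variance_nonneg _ _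
    have hR : 0 < max (rE - 1) 1 := lt_max_of_lt_right one_pos
    refine ⟨?_, sub_le_sub_left (fbt_le_fbn s ?_ ?_ hr.1) 1⟩
    · have h := one_sub_fbt_le_measureReal_mmse_lt hPx hσ hx hw hxw hK hη hp
        -- The energy normalized to mean one has variance `Q ϱE / (Q μE)²` and takes values in `[0,
        -- rE]`, which gives `v` and `R`.
        (b := fun k ω => slotEnergy E k ω / (Q * μE)) (v := ϱE / μE ^ 2 * (1 / Q))
        (R := max (rE - 1) 1) (a := μE)
        (fun k => (hSm k).div_const _)
        (fun S k hk => (hSind S k hk).comp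
          (φ := fun (c : S → ℝ) (j : S) => c j / (Q * μE)) (ψ := fun c : ℝ => c / (Q * μE))
          (by fun_prop) (by fun_prop))
        (fun k => by
          rw [integral_div, integral_slotEnergy (fun t => (hL2 t).integrable one_le_two) hEmean]
          exact div_self (by positivity))
        (fun k => by
          have h := variance_slotEnergy hL2 hEindep hEvar k
          rw [variance_eq_integral (hSm k).aemeasurable,
            integral_slotEnergy (fun t => (hL2 t).integrable one_le_two) hEmean] at h
          have e : ∀ ω, (1 - slotEnergy E k ω / (Q * μE)) ^ 2 =
              (1 / (Q * μE) ^ 2) * (slotEnergy E k ω - Q * μE) ^ 2 := fun ω => by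
            field_simp
            ring
          simp only [e]
          rw [integral_const_mul, h]
          field_simp)
        (by positivity) hR
        (fun k => by
          filter_upwards [slotEnergy_bounds hEbound k] with ω hω
          have h1 : 0 ≤ slotEnergy E k ω / (Q * μE) := div_nonneg hω.1 (by positivity)
          have h2 : slotEnergy E k ω / (Q * μE) ≤ rE := by
            rw [div_le_iff₀ (by positivity)]
            linarith [hω.2]
          rw [abs_le]
          constructor
          · linarith [le_max_left (rE - 1) 1]
          · linarith [le_max_right (rE - 1) 1])
        hμE
        (fun k => Filter.Eventually.of_forall fun ω => le_of_eq (by field_simp)) hr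
      have e : ϱE / μE ^ 2 * (1 / Q) * (1 / etaL U ^ 2) * min (Q * etaU U) 1 =
          rhoI Q (etaL U) (etaU U) μE ϱE := by
        rw [rhoI]; ring
      rw [e] at h
      exact h
    · unfold muI; positivity
    · unfold rhoI; positivity
  · have hle1 : pbar ≤ 1 := hpbar ▸ measureReal_le_one
    have hv : 0 ≤ 1 / pbar - 1 := by
      rw [sub_nonneg, le_div_iff₀ hpos, one_mul]; exact hle1
    have hR : 0 < max (1 / pbar - 1) 1 := lt_max_of_lt_right one_pos
    refine ⟨?_, sub_le_sub_left (fbt_le_fbn s ?_ ?_ hr.1) 1⟩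
    -- The indicator of a sufficiently charged slot, scaled to mean one. Its variance is `1 / pbar -
    -- 1`, and `a * b k * Q` becomes `γ * μE` or `0`, never more than the slot energy.
    · let ψ : ℝ → ℝ := Set.indicator (Set.Ici (γ * μE)) fun _ => 1 / pbar
      have hψ : Measurable ψ := measurable_const.indicator measurableSet_Ici
      -- All slots share the probability given for `k₀`, by equality of laws.
      have hprob : ∀ k, PE.real {ω | slotEnergy E k ω ≥ γ * μE} = pbar := fun k => by
        rw [hpbar]
        exact congrArg ENNReal.toReal ((identDistrib_slotEnergy hEindep hEident k k₀).measure_mem_eq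
          (measurableSet_Ici (a := γ * μE)))
      have hInt : ∀ k (c : ℝ), ∫ ω, (Set.Ici (γ * μE)).indicator (fun _ => c) (slotEnergy E k ω) ∂PE
          = pbar * c := fun k c => by
        have e : (fun ω => (Set.Ici (γ * μE)).indicator (fun _ => c) (slotEnergy E k ω)) =
            (slotEnergy E k ⁻¹' Set.Ici (γ * μE)).indicator fun _ => c := rfl
        rw [e, integral_indicator_const _ (hSm k measurableSet_Ici), smul_eq_mul, ← hprob k]
        rfl
      have hind : ∀ k (c : ℝ), Integrable
          (fun ω => (Set.Ici (γ * μE)).indicator (fun _ => c) (slotEnergy E k ω)) PE := fun k c =>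
        (integrable_const c).indicator (hSm k measurableSet_Ici)
      have h := one_sub_fbt_le_measureReal_mmse_lt hPx hσ hx hw hxw hK hη hp
        (b := fun k ω => ψ (slotEnergy E k ω)) (v := 1 / pbar - 1)
        (R := max (1 / pbar - 1) 1) (a := 1 / Q * pbar * γ * μE)
        (fun k => hψ.comp (hSm k))
        (fun S k hk => (hSind S k hk).comp (φ := fun (c : S → ℝ) (j : S) => ψ (c j)) (ψ := ψ)
          (measurable_pi_lambda _ fun j => hψ.comp (measurable_pi_apply j)) hψ)
        (fun k => by rw [hInt]; exact mul_one_div_cancel hpos.ne')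
        (fun k => by
          -- An indicator is idempotent, so the square is affine in it and one integral settles the
          -- variance.
          have e : ∀ ω, (1 - ψ (slotEnergy E k ω)) ^ 2 = 1 +
              (Set.Ici (γ * μE)).indicator (fun _ => (1 / pbar) ^ 2 - 2 * (1 / pbar))
                (slotEnergy E k ω) := fun ω => by
            by_cases hω : slotEnergy E k ω ∈ Set.Ici (γ * μE)
            · simp only [ψ, Set.indicator_of_mem hω]; ring
            · simp only [ψ, Set.indicator_of_notMem hω]; ring
          simp only [e]
          rw [integral_add (integrable_const _) (hind _ _), hInt]
          simp only [integral_const, probReal_univ, smul_eq_mul]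
          field_simp
          ring)
        hv hR
        (fun k => Filter.Eventually.of_forall fun ω => by
          by_cases hω : slotEnergy E k ω ∈ Set.Ici (γ * μE)
          · simp only [ψ, Set.indicator_of_mem hω]
            rw [abs_sub_comm, abs_of_nonneg hv]
            exact le_max_left _ _
          · simp only [ψ, Set.indicator_of_notMem hω]
            simp)
        (mul_pos (mul_pos (mul_pos (by positivity) hpos) hγ.1) hμE)
        (fun k => by
          filter_upwards [slotEnergy_bounds hEbound k] with ω hω0
          by_cases hω : slotEnergy E k ω ∈ Set.Ici (γ * μE)
          · simp only [ψ, Set.indicator_of_mem hω]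
            refine le_trans (le_of_eq ?_) hω
            field_simp
          · simp only [ψ, Set.indicator_of_notMem hω]
            simpa using hω0.1) hr
      have e1 : (1 / pbar - 1) * (1 / etaL U ^ 2) * min (Q * etaU U) 1 =
          rhoII Q (etaL U) (etaU U) pbar := by
        rw [rhoII]; ring
      have e2 : 1 / (1 + 1 / σw2 * (1 / Q * pbar * γ * μE) * (1 / etaU U - r)) * Px =
          errII Q Px σw2 μE (etaU U) γ pbar r := by
        rw [errII]; ring
      rw [e1, e2] at h
      exact h
    · unfold muII; positivity
    · unfold rhoII; positivity
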